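/- For $r>0$ let $\mathrm{B}^2(r)\subset\mathbb{R}^2$ be the open disc of radius $r$ centred at the origin, with the area form $dx\wedge dy$. For $\epsilon>0$ let $$\Sigma(\epsilon):=(\mathbb{R}^2\setminus\sqrt\epsilon\,\mathbb{Z}^2)/\sqrt\epsilon\,\mathbb{Z}^2$$ be the punctured torus of area $\epsilon$, with the area form induced by $dx\wedge dy$; products carry the product symplectic forms. Theorem. There exist constants $\epsilon_0>0$ and $c>0$ and a smooth family $(I_\epsilon)_{\epsilon\in(0,\epsilon_0]}$ of symplectic embeddings $$I_\epsilon\colon \Sigma(\epsilon)\times \mathrm{B}^2(1)\hookrightarrow \mathrm{B}^2(\sqrt2+c\,\epsilon)\times \mathrm{B}^2(\sqrt2).$$ Here a symplectic embedding is a smooth embedding that pulls back the symplectic form of the target to that of the source. Smoothness of the family means that, after identifying $\Sigma(\epsilon)$ with $\Sigma(1)$ by scaling, the maps depend smoothly on all variables jointly, up to the end point $\epsilon_0$: there are an open set $U\subset\mathbb{R}$ containing $(0,\epsilon_0]$ and a smooth map $\Phi\colon U\times\Sigma(1)\times \mathrm{B}^2(1)\to\mathbb{R}^2\times\mathbb{R}^2$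 with $\Phi(\epsilon,[z],b)=I_\epsilon([\sqrt\epsilon\, z],b)$ for all $\epsilon\in(0,\epsilon_0]$, $[z]\in\Sigma(1)$ and $b\in \mathrm{B}^2(1)$. -/

import Mathlib

open scoped Manifold ContDiff

noncomputable section

/-! ### The smooth structure on the circle `ℝ / pℤ` -/

/-- The charts of `ℝ / pℤ` are the local inverses of the covering map `ℝ → ℝ / pℤ`. -/
instance AddCircle.instChartedSpaceReal (p : ℝ) : ChartedSpace ℝ (AddCircle p) :=
  (AddCircle.isLocalHomeomorph_coe p).chartedSpace QuotientAddGroup.mk_surjective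

/-- A chart of `ℝ / pℤ` composed with the covering map is locally a translation. -/
theorem AddCircle.atlas_comp_coe_eventuallyEq {p : ℝ}
    {e : OpenPartialHomeomorph (AddCircle p) ℝ} (he : e ∈ atlas ℝ (AddCircle p))
    {t : ℝ} (ht : (t : AddCircle p) ∈ e.source) :
    ∃ k : ℝ, ∀ᶠ s : ℝ in nhds t, e (s : AddCircle p) = s + k := by
  obtain ⟨q, rfl⟩ := he
  set hf := AddCircle.isLocalHomeomorph_coe p
  set g := (QuotientAddGroup.mk_surjective (s := AddSubgroup.zmultiples p)).hasRightInverse.choose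
  set e' := (hf.localInverseAt (g q)).trans (chartAt ℝ (g q)) with he'
  have hsrc : e'.source = (hf.localInverseAt (g q)).source := by simp [he', chartAt_self_eq]
  have happ : ∀ x, e' x = hf.localInverseAt (g q) x := fun x => by simp [he', chartAt_self_eq]
  have hright : ∀ x ∈ e'.source, ((e' x : ℝ) : AddCircle p) = x := by
    intro x hx
    rw [happ]
    exact hf.apply_localInverseAt_of_mem (hsrc ▸ hx)
  have hinj : e'.target.InjOn ((↑) : ℝ → AddCircle p) := by
    have : e'.target = (hf.localInverseAt (g q)).target := by simp [he', chartAt_self_eq]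
    rw [this]
    exact hf.injOn_localInverseAt_target
  refine ⟨e' t - t, ?_⟩
  have hk : ((e' t - t : ℝ) : AddCircle p) = 0 := by
    rw [AddCircle.coe_sub, hright _ ht, sub_self]
  have h1 : ∀ᶠ s : ℝ in nhds t, (s : AddCircle p) ∈ e'.source :=
    (AddCircle.continuous_mk' p).continuousAt.eventually (e'.open_source.mem_nhds ht)
  have h2 : ∀ᶠ s : ℝ in nhds t, s + (e' t - t) ∈ e'.target := by
    have hc : ContinuousAt (fun s : ℝ => s + (e' t - t)) t := by fun_prop
    refine hc.eventually (e'.open_target.mem_nhds ?_)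
    simpa using e'.map_source ht
  filter_upwards [h1, h2] with s hs1 hs2
  refine hinj (e'.map_source hs1) hs2 ?_
  rw [hright _ hs1, AddCircle.coe_add, hk, add_zero]

theorem AddCircle.coe_atlas_symm {p : ℝ}
    {e : OpenPartialHomeomorph (AddCircle p) ℝ} (he : e ∈ atlas ℝ (AddCircle p)) (t : ℝ) :
    e.symm t = (t : AddCircle p) := by
  obtain ⟨q, rfl⟩ := he
  simp [chartAt_self_eq]

instance AddCircle.instIsManifoldReal (p : ℝ) : IsManifold 𝓘(ℝ) ∞ (AddCircle p) := by
  refine isManifold_of_contDiffOn 𝓘(ℝ) ∞ (AddCircle p) ?_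
  intro e e' he he' t ht
  simp only [mfld_simps] at ht ⊢
  refine ContDiffAt.contDiffWithinAt ?_
  have ht' : (t : AddCircle p) ∈ e'.source := by
    rw [← AddCircle.coe_atlas_symm he]; exact ht.2
  obtain ⟨k, hk⟩ := AddCircle.atlas_comp_coe_eventuallyEq he' ht'
  refine ContDiffAt.congr_of_eventuallyEq (f := fun s : ℝ => s + k) (by fun_prop) ?_
  filter_upwards [hk] with s hs
  simp [AddCircle.coe_atlas_symm he, hs]

theorem AddCircle.contMDiff_coe (p : ℝ) :
    ContMDiff 𝓘(ℝ) 𝓘(ℝ) ∞ ((↑) : ℝ → AddCircle p) := by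
  intro t
  rw [contMDiffAt_iff]
  refine ⟨(AddCircle.continuous_mk' p).continuousAt, ?_⟩
  obtain ⟨k, hk⟩ := AddCircle.atlas_comp_coe_eventuallyEq
    (chart_mem_atlas ℝ (t : AddCircle p)) (mem_chart_source ℝ (t : AddCircle p))
  simp only [mfld_simps, chartAt_self_eq]
  refine ContDiffAt.contDiffWithinAt ?_
  refine ContDiffAt.congr_of_eventuallyEq (f := fun s : ℝ => s + k) (by fun_prop) ?_
  filter_upwards [hk] with s hs
  simpa using hs

/-- With the tangent space of `ℝ / pℤ` at a point identified with `ℝ` through the chart there, the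
derivative of the covering map is the identity. -/
theorem AddCircle.mfderiv_coe (p t : ℝ) :
    mfderiv 𝓘(ℝ) 𝓘(ℝ) ((↑) : ℝ → AddCircle p) t = ContinuousLinearMap.id ℝ ℝ := by
  obtain ⟨k, hk⟩ := AddCircle.atlas_comp_coe_eventuallyEq
    (chart_mem_atlas ℝ (t : AddCircle p)) (mem_chart_source ℝ (t : AddCircle p))
  rw [((AddCircle.contMDiff_coe p).mdifferentiable (by simp) t).mfderiv]
  simp only [mfld_simps, chartAt_self_eq, fderivWithin_univ]
  have : (writtenInExtChartAt 𝓘(ℝ) 𝓘(ℝ) t ((↑) : ℝ → AddCircle p))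
      =ᶠ[nhds t] fun s : ℝ => s + k := by
    filter_upwards [hk] with s hs
    simpa [writtenInExtChartAt, chartAt_self_eq] using hs
  have h2 : fderiv ℝ (writtenInExtChartAt 𝓘(ℝ) 𝓘(ℝ) t ((↑) : ℝ → AddCircle p)) t
      = ContinuousLinearMap.id ℝ ℝ := by
    rw [this.fderiv_eq]
    simp [fderiv_add_const]
  exact h2

/-! ### Two-forms, symplectic embeddings -/

section General

variable {E H : Type*} [NormedAddCommGroup E] [NormedSpace ℝ E] [TopologicalSpace H]
  {E' H' : Type*} [NormedAddCommGroup E'] [NormedSpace ℝ E'] [TopologicalSpace H']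

/-- A field of real-valued functions of two tangent vectors; the two-forms below are of this kind. -/
abbrev FormField (I : ModelWithCorners ℝ E H) (M : Type*) [TopologicalSpace M]
    [ChartedSpace H M] : Type _ :=
  ∀ x : M, TangentSpace I x → TangentSpace I x → ℝ

/-- The pull-back `f^* β`. -/
def FormField.pullback {I : ModelWithCorners ℝ E H} {J : ModelWithCorners ℝ E' H'}
    {M N : Type*} [TopologicalSpace M] [ChartedSpace H M] [TopologicalSpace N] [ChartedSpace H' N]
    (β : FormField J N) (f : M → N) : FormField I M :=
  fun x u v => β (f x) (mfderiv I J f x u) (mfderiv I J f x v)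

/-- The product form `pr₁^* α + pr₂^* β`. -/
def FormField.prod {I : ModelWithCorners ℝ E H} {J : ModelWithCorners ℝ E' H'}
    {M N : Type*} [TopologicalSpace M] [ChartedSpace H M] [TopologicalSpace N] [ChartedSpace H' N]
    (α : FormField I M) (β : FormField J N) : FormField (I.prod J) (M × N) :=
  fun x u v => α.pullback (I := I.prod J) Prod.fst x u v + β.pullback (I := I.prod J) Prod.snd x u v

/-- A symplectic embedding `f : (M, α) → (N, β)`: a smooth embedding with `f^* β = α`. -/
structure IsSymplecticEmbedding {I : ModelWithCorners ℝ E H} {J : ModelWithCorners ℝ E' H'}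
    {M N : Type*} [TopologicalSpace M] [ChartedSpace H M] [TopologicalSpace N] [ChartedSpace H' N]
    (α : FormField I M) (β : FormField J N) (f : M → N) : Prop where
  contMDiff : ContMDiff I J ∞ f
  immersion : ∀ x, Function.Injective (mfderiv I J f x)
  isEmbedding : Topology.IsEmbedding f
  pullback_eq : β.pullback f = α

/-- Smoothness of a family of maps `φ p : X p → M`, `p ∈ P ⊆ ℝ`, whose domains are parametrized by
`g p : B → X p` with a fixed manifold `B`: the map `(p, b) ↦ φ p (g p b)` on `P × B` extends to a
smooth map on `U × B` for some open neighbourhood `U` of `P`. -/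
def IsSmoothFamily (I : ModelWithCorners ℝ E H) (J : ModelWithCorners ℝ E' H')
    {B M : Type*} [TopologicalSpace B] [ChartedSpace H B] [TopologicalSpace M] [ChartedSpace H' M]
    (P : Set ℝ) {X : ℝ → Type*} (g : ∀ p ∈ P, B → X p) (φ : ∀ p, X p → M) : Prop :=
  ∃ (U : Set ℝ) (Φ : ℝ × B → M), IsOpen U ∧ P ⊆ U ∧
    ContMDiffOn (𝓘(ℝ).prod I) J ∞ Φ (U ×ˢ Set.univ) ∧
    ∀ p (hp : p ∈ P) (b : B), Φ (p, b) = φ p (g p hp b)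

end General

/-! ### The plane, discs, and punctured tori -/

/-- The area form `dx ∧ dy` on `ℝ²`. -/
def planeForm : FormField 𝓘(ℝ, ℝ × ℝ) (ℝ × ℝ) :=
  fun _ (u v : ℝ × ℝ) => u.1 * v.2 - u.2 * v.1

/-- The open disc `B²(r)` of radius `r` centred at the origin of `ℝ²`. -/
def disc (r : ℝ) : TopologicalSpace.Opens (ℝ × ℝ) where
  carrier := {z | Real.sqrt (z.1 ^ 2 + z.2 ^ 2) < r}
  is_open' := isOpen_lt (by fun_prop) continuous_const

/-- The restriction of `dx ∧ dy` to the disc. -/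
def discForm (r : ℝ) : FormField 𝓘(ℝ, ℝ × ℝ) (disc r) :=
  planeForm.pullback (Subtype.val : disc r → ℝ × ℝ)

/-- The torus `ℝ² / aℤ²`, with the product smooth structure. -/
abbrev Torus (a : ℝ) : Type := AddCircle a × AddCircle a

/-- The covering map `ℝ² → ℝ² / aℤ²`. -/
def torusProj (a : ℝ) : ℝ × ℝ → Torus a := fun z => ((z.1 : AddCircle a), (z.2 : AddCircle a))

/-- The area form on `ℝ² / aℤ²` induced by `dx ∧ dy`. The tangent space at a point is `ℝ × ℝ`
through the chart at that point, which is a local inverse of the covering map; the characterization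
`torusProj^* (torusForm a) = dx ∧ dy` is proved in `torusForm_pullback_torusProj` below. -/
def torusForm (a : ℝ) : FormField (𝓘(ℝ).prod 𝓘(ℝ)) (Torus a) :=
  fun _ (u v : ℝ × ℝ) => u.1 * v.2 - u.2 * v.1

theorem torusForm_pullback_torusProj (a : ℝ) :
    (torusForm a).pullback (I := 𝓘(ℝ).prod 𝓘(ℝ)) (torusProj a)
      = fun _ (u v : ℝ × ℝ) => u.1 * v.2 - u.2 * v.1 := by
  funext x u v
  have h1 : ∀ t : ℝ, MDifferentiableAt 𝓘(ℝ) 𝓘(ℝ) ((↑) : ℝ → AddCircle a) t := fun t =>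
    (AddCircle.contMDiff_coe a).mdifferentiable (by simp) t
  have h := mfderiv_prodMap (p := x) (h1 x.1) (h1 x.2)
  have h2 : ∀ w : ℝ × ℝ, mfderiv (𝓘(ℝ).prod 𝓘(ℝ)) (𝓘(ℝ).prod 𝓘(ℝ)) (torusProj a) x w = w := by
    intro w
    change mfderiv (𝓘(ℝ).prod 𝓘(ℝ)) (𝓘(ℝ).prod 𝓘(ℝ))
      (Prod.map ((↑) : ℝ → AddCircle a) ((↑) : ℝ → AddCircle a)) x w = w
    rw [h, AddCircle.mfderiv_coe, AddCircle.mfderiv_coe]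
    rfl
  change torusForm a _ (mfderiv _ _ _ x u) (mfderiv _ _ _ x v) = _
  rw [h2 u, h2 v]
  rfl

/-- The punctured torus `(ℝ² \ aℤ²) / aℤ²`, as an open subset of `ℝ² / aℤ²`. -/
def puncturedTorus (a : ℝ) : TopologicalSpace.Opens (Torus a) where
  carrier := {0}ᶜ
  is_open' := isOpen_compl_singleton

/-- The area form of the punctured torus, of total area `a²`. -/
def puncturedTorusForm (a : ℝ) : FormField (𝓘(ℝ).prod 𝓘(ℝ)) (puncturedTorus a) :=
  (torusForm a).pullback (Subtype.val : puncturedTorus a → Torus a)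

/-- The scaling diffeomorphism `[z] ↦ [a z]` from `(ℝ² \ ℤ²) / ℤ²` to `(ℝ² \ aℤ²) / aℤ²`. -/
def puncturedTorusScale (a : ℝ) (ha : 0 < a) (σ : puncturedTorus 1) : puncturedTorus a :=
  ⟨(AddCircle.equivAddCircle 1 a one_ne_zero ha.ne' σ.1.1,
    AddCircle.equivAddCircle 1 a one_ne_zero ha.ne' σ.1.2), by
    have h := σ.2
    simp only [puncturedTorus, TopologicalSpace.Opens.mem_mk, Set.mem_compl_iff,
      Set.mem_singleton_iff, Prod.ext_iff, Prod.fst_zero, Prod.snd_zero,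
      EmbeddingLike.map_eq_zero_iff] at h ⊢
    exact h⟩

end

noncomputable section

/-! Open the puncture of `ℝ²/ℤ²` to a hole of radius `√2/3`, use the coordinates `q = x + y`, `s = y
- x`, and cut along `s ∈ ℤ`. This gives a closed band `0 ≤ s < 1` of length 2 in `q`. Its upper edge
at `q + 1` is glued to its lower edge at `q`, but the hole leaves of this edge only windows, where
`q` is within `1/3` of an odd integer (`stripCoord_window`). Let the band run twice around an
annulus of circumference 1 in `q`. At a window the strand at `q` lies directly on top of the strand
at `q + 1`, so the gluing is respected (`model_window`). On the way from window to window the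
strands exchange levels and have to cross: the annulus receives only an immersion.

The crossing is resolved in the second factor. The disc `B²(1)` is mapped to the rectangle `(0, π) ×
(0, 1)`, which in angle and action `R` is a half disc of `B²(√2)`. One strand is rotated by `π`
before the crossing, so that the two half discs are disjoint there, and by another `π` afterwards,
so that the total is a full turn. For the map to be symplectic, the rotation by `twist q` must be
accompanied by a shear `twistDeriv q * R` across the annulus. Before the crossing the rotating
strand is the upper one and the shear pushes it away from the other. After the crossing it is the
lower one, and `roof` lifts the other strand out of its way.

Each half turn costs area `π`, and together they fill the area `2π` of `B²(√2)`. The rest of the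
band has thickness of order `ε`. Hence `position` gives almost the whole angle of the annulus to the
two half turns, and the action in the first factor stays below `1 + O(ε)` (`offset_lt`).

Injectivity is `model_inj`, with `no_crossing` as its geometric content. The symplectic identity is
`hasFDerivAt_flatMap`. Smoothness across the cuts is `planeMap_eventuallyEq`. The dimensions being
equal, an injective local diffeomorphism is open and hence an embedding. -/

/-! ### A smooth staircase -/

/-- A smooth staircase: `stair (p + 2) = stair p + 1`, rising on `[0, 1/24] + 2ℤ`, and constant on
the complement. -/
def stair (p : ℝ) : ℝ := ⌊p / 2⌋ + Real.smoothTransition (24 * (p - 2 * ⌊p / 2⌋))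

/-- The interval starts where the previous step ends, at `2 * (m - 1) + 1/24`, so that one smooth
formula is valid on both sides of the jump of the floor. -/
theorem stair_eq (m : ℤ) {p : ℝ} (h₁ : 2 * m - 47 / 24 ≤ p) (h₂ : p < 2 * m + 2) :
    stair p = m + Real.smoothTransition (24 * (p - 2 * m)) := by
  unfold stair
  rcases le_or_gt (2 * (m : ℝ)) p with h | h
  · have : ⌊p / 2⌋ = m := by
      rw [Int.floor_eq_iff]; constructor <;> linarith
    rw [this]
  · have : ⌊p / 2⌋ = m - 1 := by
      rw [Int.floor_eq_iff]; push_cast; constructor <;> linarith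
    rw [this, Real.smoothTransition.zero_of_nonpos (x := 24 * (p - 2 * m)) (by linarith),
      Real.smoothTransition.one_of_one_le (by push_cast; linarith)]
    push_cast; ring

theorem stair_add_two (p : ℝ) : stair (p + 2) = stair p + 1 := by
  have : ⌊(p + 2) / 2⌋ = ⌊p / 2⌋ + 1 := by
    rw [← Int.floor_add_one]; congr 1; ring
  unfold stair
  rw [this]; push_cast
  rw [show p + 2 - 2 * ((⌊p / 2⌋ : ℝ) + 1) = p - 2 * ⌊p / 2⌋ by ring]; ring

theorem exists_stair_eventuallyEq (p : ℝ) :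
    ∃ m : ℤ, stair =ᶠ[nhds p] fun p => m + Real.smoothTransition (24 * (p - 2 * m)) := by
  refine ⟨⌊p / 2⌋, ?_⟩
  have h₁ := Int.floor_le (p / 2)
  have h₂ := Int.lt_floor_add_one (p / 2)
  filter_upwards [Ioo_mem_nhds (a := 2 * (⌊p / 2⌋ : ℝ) - 47 / 24) (b := 2 * (⌊p / 2⌋ : ℝ) + 2)
    (by linarith) (by linarith)] with x hx
  exact stair_eq _ hx.1.le hx.2

theorem contDiff_stair : ContDiff ℝ ∞ stair := by
  rw [contDiff_iff_contDiffAt]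
  intro p
  obtain ⟨m, hm⟩ := exists_stair_eventuallyEq p
  refine ContDiffAt.congr_of_eventuallyEq ?_ hm
  have : ContDiff ℝ ∞ Real.smoothTransition := Real.smoothTransition.contDiff
  fun_prop

theorem differentiable_stair : Differentiable ℝ stair := contDiff_stair.differentiable (by simp)

theorem contDiff_deriv_stair : ContDiff ℝ ∞ (deriv stair) :=
  (contDiff_infty_iff_deriv.1 contDiff_stair).2

theorem stair_eq_const (m : ℤ) {p : ℝ} (h₁ : 2 * m - 47 / 24 ≤ p) (h₂ : p ≤ 2 * m) :
    stair p = m := by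
  rw [stair_eq m h₁ (by linarith), Real.smoothTransition.zero_of_nonpos (by linarith), add_zero]

theorem deriv_stair_nonneg (p : ℝ) : 0 ≤ deriv stair p := by
  obtain ⟨m, hm⟩ := exists_stair_eventuallyEq p
  rw [hm.deriv_eq]
  refine Monotone.deriv_nonneg (fun x y hxy => ?_)
  have := Real.smoothTransition.monotone (a := 24 * (x - 2 * m)) (b := 24 * (y - 2 * m))
    (by linarith)
  simpa using this

theorem stair_mono : Monotone stair :=
  monotone_of_deriv_nonneg differentiable_stair deriv_stair_nonneg

theorem deriv_stair_add_two (p : ℝ) : deriv stair (p + 2) = deriv stair p := by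
  rw [← deriv_comp_add_const]
  have : (fun x => stair (x + 2)) = fun x => stair x + 1 := funext stair_add_two
  rw [this, deriv_add_const]

theorem deriv_stair_eq_zero (m : ℤ) {p : ℝ} (h₁ : 2 * m - 47 / 24 < p) (h₂ : p < 2 * m) :
    deriv stair p = 0 := by
  have : stair =ᶠ[nhds p] fun _ => (m : ℝ) := by
    filter_upwards [Ioo_mem_nhds h₁ h₂] with x hx
    exact stair_eq_const m hx.1.le hx.2.le
  rw [this.deriv_eq, deriv_const]

/-! ### A radial profile -/

/-- An increasing smooth function with `opened (2/9) = 0` and `opened t = t` for large `t`. -/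
def opened (t : ℝ) : ℝ := t - 2 / 9 * (1 - Real.smoothTransition (72 * t - 16))

theorem contDiff_opened : ContDiff ℝ ∞ opened := by
  have : ContDiff ℝ ∞ Real.smoothTransition := Real.smoothTransition.contDiff
  unfold opened; fun_prop

theorem opened_of_ge {t : ℝ} (h : 17 / 72 ≤ t) : opened t = t := by
  rw [opened, Real.smoothTransition.one_of_one_le (by linarith)]; ring

theorem opened_two_ninths : opened (2 / 9) = 0 := by
  rw [opened, Real.smoothTransition.zero_of_nonpos (by norm_num)]; ring

theorem one_le_deriv_opened (t : ℝ) : 1 ≤ deriv opened t := by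
  have hm : Monotone fun t => opened t - t := by
    intro x y hxy
    have := Real.smoothTransition.monotone (a := 72 * x - 16) (b := 72 * y - 16) (by linarith)
    simp only [opened]; linarith
  have := hm.deriv_nonneg (x := t)
  rw [deriv_fun_sub (contDiff_opened.differentiable (by simp) t) differentiableAt_fun_id] at this
  simp at this
  exact this

theorem deriv_opened_of_gt {t : ℝ} (h : 17 / 72 < t) : deriv opened t = 1 := by
  have : opened =ᶠ[nhds t] id := by
    filter_upwards [Ioi_mem_nhds h] with x hx
    exact opened_of_ge (le_of_lt hx)
  rw [this.deriv_eq]; simp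

theorem strictMono_opened : StrictMono opened :=
  strictMono_of_deriv_pos fun t => zero_lt_one.trans_le (one_le_deriv_opened t)

theorem surjective_opened : Function.Surjective opened := by
  refine contDiff_opened.continuous.surjective ?_ ?_
  · refine Filter.tendsto_atTop_mono' _ ?_ Filter.tendsto_id
    filter_upwards [Filter.eventually_ge_atTop (17 / 72)] with t ht
    exact (opened_of_ge ht).ge
  · refine Filter.tendsto_atBot_mono (fun t => ?_) Filter.tendsto_id
    have := Real.smoothTransition.le_one (72 * t - 16)
    simp only [opened, id]; linarith

/-- `opened` as a homeomorphism. -/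
def openedHomeomorph : ℝ ≃ₜ ℝ :=
  (strictMono_opened.orderIsoOfSurjective _ surjective_opened).toHomeomorph

/-- The inverse of `opened`. -/
def blow (s : ℝ) : ℝ := openedHomeomorph.symm s

theorem opened_blow (s : ℝ) : opened (blow s) = s := openedHomeomorph.apply_symm_apply s

theorem blow_opened (t : ℝ) : blow (opened t) = t := openedHomeomorph.symm_apply_apply t

theorem contDiff_blow : ContDiff ℝ ∞ blow :=
  openedHomeomorph.contDiff_symm_deriv
    (fun t => (zero_lt_one.trans_le (one_le_deriv_opened t)).ne')
    (fun t => (contDiff_opened.differentiable (by simp) t).hasDerivAt) contDiff_opened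

theorem strictMono_blow : StrictMono blow := fun a b h => by
  rw [← strictMono_opened.lt_iff_lt, opened_blow, opened_blow]; exact h

theorem blow_of_ge {s : ℝ} (h : 17 / 72 ≤ s) : blow s = s := by
  conv_lhs => rw [← opened_of_ge h]
  exact blow_opened s

theorem blow_zero : blow 0 = 2 / 9 := by rw [← opened_two_ninths, blow_opened]

theorem blow_pos {s : ℝ} (h : 0 ≤ s) : 0 < blow s := by
  have := strictMono_blow.monotone h
  rw [blow_zero] at this; linarith

theorem deriv_opened_mul_deriv_blow (s : ℝ) : deriv opened (blow s) * deriv blow s = 1 := by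
  have h₁ := (contDiff_opened.differentiable (by simp) (blow s)).hasDerivAt
  have h₂ := (contDiff_blow.differentiable (by simp) s).hasDerivAt
  have h := h₁.comp s h₂
  have h' : opened ∘ blow = id := funext opened_blow
  rw [h'] at h
  exact h.unique (hasDerivAt_id s)

/-! ### Integrals depending on a parameter -/

section ParametricIntegral

variable {E : Type} [NormedAddCommGroup E] [NormedSpace ℝ E] [ProperSpace E]

/-- Differentiation under the integral sign: a constant dominates the partial derivative on the
compact product of a closed ball and `[0, 1]`. -/
theorem hasFDerivAt_integral_zero_one {F : Type} [NormedAddCommGroup F] [NormedSpace ℝ F]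
    {h : E × ℝ → F} (hh : ContDiff ℝ ∞ h) (z : E) :
    HasFDerivAt (fun z => ∫ t in (0 : ℝ)..1, h (z, t))
      (∫ t in (0 : ℝ)..1, (fderiv ℝ h (z, t)).comp (ContinuousLinearMap.inl ℝ E ℝ)) z := by
  have hd : Continuous fun p : E × ℝ => (fderiv ℝ h p).comp (ContinuousLinearMap.inl ℝ E ℝ) :=
    (hh.continuous_fderiv (by simp)).clm_comp continuous_const
  obtain ⟨C, hC⟩ := ((isCompact_closedBall z 1).prod
    (isCompact_Icc (a := (0 : ℝ)) (b := 1))).exists_bound_of_continuousOn hd.continuousOn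
  refine intervalIntegral.hasFDerivAt_integral_of_dominated_of_fderiv_le (bound := fun _ => C)
    (F' := fun z t => (fderiv ℝ h (z, t)).comp (ContinuousLinearMap.inl ℝ E ℝ))
    (Metric.ball_mem_nhds z one_pos) ?_ ?_ ?_ ?_ ?_ ?_
  · exact Filter.Eventually.of_forall fun x =>
      (hh.continuous.comp (by fun_prop : Continuous fun t : ℝ => (x, t))).aestronglyMeasurable
  · exact (hh.continuous.comp
      (by fun_prop : Continuous fun t : ℝ => (z, t))).intervalIntegrable _ _
  · exact (hd.comp (by fun_prop : Continuous fun t : ℝ => (z, t))).aestronglyMeasurable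
  · refine Filter.Eventually.of_forall fun t ht x hx =>
      hC (x, t) ⟨Metric.ball_subset_closedBall hx, ?_⟩
    rw [Set.uIoc_of_le zero_le_one] at ht
    exact ⟨ht.1.le, ht.2⟩
  · exact intervalIntegrable_const
  · refine Filter.Eventually.of_forall fun t _ x _ => ?_
    have h₁ : HasFDerivAt h (fderiv ℝ h (x, t)) (x, t) :=
      (hh.differentiable (by simp) (x, t)).hasFDerivAt
    have h₂ : HasFDerivAt (fun y : E => (y, t)) (ContinuousLinearMap.inl ℝ E ℝ) x :=
      hasFDerivAt_prodMk_left x t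
    exact h₁.comp x h₂

/-- The derivative is an integral of the same kind with values in a space of linear maps, so the
induction on the order runs over all `F`. -/
theorem contDiff_integral_zero_one {F : Type} [NormedAddCommGroup F] [NormedSpace ℝ F]
    {h : E × ℝ → F} (hh : ContDiff ℝ ∞ h) :
    ContDiff ℝ ∞ fun z => ∫ t in (0 : ℝ)..1, h (z, t) := by
  rw [contDiff_infty]
  intro n
  induction n generalizing F with
  | zero =>
    exact contDiff_zero.2 (continuous_iff_continuousAt.2 fun z =>
      (hasFDerivAt_integral_zero_one hh z).continuousAt)
  | succ n ih =>
    rw [Nat.cast_succ, contDiff_succ_iff_hasFDerivAt]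
    refine ⟨_, ih (h := fun p => (fderiv ℝ h p).comp (ContinuousLinearMap.inl ℝ E ℝ)) ?_,
      hasFDerivAt_integral_zero_one hh⟩
    exact (hh.fderiv_right (by simp)).clm_comp contDiff_const

end ParametricIntegral

/-- The substitution `s = z.2 * t` moves the variable end point into the integrand. -/
theorem contDiff_primitive_snd {g : ℝ × ℝ → ℝ} (hg : ContDiff ℝ ∞ g) :
    ContDiff ℝ ∞ fun z : ℝ × ℝ => ∫ s in (0 : ℝ)..z.2, g (z.1, s) := by
  have h : (fun z : ℝ × ℝ => ∫ s in (0 : ℝ)..z.2, g (z.1, s))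
      = fun z => z.2 * ∫ t in (0 : ℝ)..1, g (z.1, z.2 * t) := by
    funext z
    have := intervalIntegral.smul_integral_comp_mul_left (a := 0) (b := 1)
      (fun s => g (z.1, s)) z.2
    simpa using this.symm
  rw [h]
  refine contDiff_snd.mul
    (contDiff_integral_zero_one (h := fun p : (ℝ × ℝ) × ℝ => g (p.1.1, p.1.2 * p.2)) ?_)
  exact hg.comp (by fun_prop)

/-! ### Jacobians of maps of the plane -/

/-- The standard area form of the plane. -/
def area (u v : ℝ × ℝ) : ℝ := u.1 * v.2 - u.2 * v.1

/-- `f` is differentiable at `z`, and its derivative multiplies areas by `k`. -/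
def HasJacobianAt (f : ℝ × ℝ → ℝ × ℝ) (k : ℝ) (z : ℝ × ℝ) : Prop :=
  ∃ f' : ℝ × ℝ →L[ℝ] ℝ × ℝ, HasFDerivAt f f' z ∧ ∀ u v, area (f' u) (f' v) = k * area u v

theorem HasJacobianAt.comp {f g : ℝ × ℝ → ℝ × ℝ} {k l : ℝ} {z : ℝ × ℝ}
    (hg : HasJacobianAt g l (f z)) (hf : HasJacobianAt f k z) :
    HasJacobianAt (g ∘ f) (l * k) z := by
  obtain ⟨f', hf, hf'⟩ := hf
  obtain ⟨g', hg, hg'⟩ := hg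
  refine ⟨_, hg.comp z hf, fun u v => ?_⟩
  simp only [ContinuousLinearMap.comp_apply, hg', hf', mul_assoc]

theorem HasJacobianAt.congr {f g : ℝ × ℝ → ℝ × ℝ} {k : ℝ} {z : ℝ × ℝ}
    (hf : HasJacobianAt f k z) (h : g =ᶠ[nhds z] f) : HasJacobianAt g k z := by
  obtain ⟨f', hf, hf'⟩ := hf
  exact ⟨f', hf.congr_of_eventuallyEq h, hf'⟩

theorem hasJacobianAt_add_const (c z : ℝ × ℝ) : HasJacobianAt (fun z => z + c) 1 z :=
  ⟨_, (hasFDerivAt_id z).add_const c, fun u v => by simp⟩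

/-- A map that is a multiple of the identity, by a factor that depends on the squared norm. -/
theorem hasJacobianAt_radial {g : ℝ → ℝ} {g' : ℝ} {w : ℝ × ℝ}
    (hg : HasDerivAt g g' (w.1 ^ 2 + w.2 ^ 2)) :
    HasJacobianAt (fun w => (g (w.1 ^ 2 + w.2 ^ 2) * w.1, g (w.1 ^ 2 + w.2 ^ 2) * w.2))
      (g (w.1 ^ 2 + w.2 ^ 2) ^ 2
        + 2 * (w.1 ^ 2 + w.2 ^ 2) * g (w.1 ^ 2 + w.2 ^ 2) * g') w := by
  have h₁ : HasFDerivAt (fun w : ℝ × ℝ => w.1) (ContinuousLinearMap.fst ℝ ℝ ℝ) w := hasFDerivAt_fst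
  have h₂ : HasFDerivAt (fun w : ℝ × ℝ => w.2) (ContinuousLinearMap.snd ℝ ℝ ℝ) w := hasFDerivAt_snd
  have h := hg.comp_hasFDerivAt w ((h₁.pow 2).add (h₂.pow 2))
  refine ⟨_, (h.mul h₁).prodMk (h.mul h₂), fun u v => ?_⟩
  simp [area]
  ring

/-! ### Opening a puncture to a hole -/

/-- The squared Euclidean norm. -/
def nsq (w : ℝ × ℝ) : ℝ := w.1 ^ 2 + w.2 ^ 2

/-- The difference between a point of the plane and a nearest integral point. -/
def cell (z : ℝ × ℝ) : ℝ × ℝ := (z.1 - round z.1, z.2 - round z.2)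

/-- An integral point nearest to `z`. -/
def center (z : ℝ × ℝ) : ℝ × ℝ := (round z.1, round z.2)

theorem cell_eq (z : ℝ × ℝ) : cell z = z - center z := rfl

theorem abs_lt_half_of_nsq {w : ℝ × ℝ} (h : nsq w < 1 / 4) : |w.1| < 1 / 2 ∧ |w.2| < 1 / 2 := by
  unfold nsq at h
  constructor <;> apply abs_lt_of_sq_lt_sq _ (by norm_num) <;>
    nlinarith [sq_nonneg w.1, sq_nonneg w.2]

theorem center_add_of_abs_lt {ℓ : ℝ × ℝ} {m n : ℤ} (hℓ : ℓ = ((m : ℝ), (n : ℝ))) {w : ℝ × ℝ}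
    (h₁ : |w.1| < 1 / 2) (h₂ : |w.2| < 1 / 2) : center (ℓ + w) = ℓ := by
  subst hℓ
  rw [abs_lt] at h₁ h₂
  have e₁ : round ((m : ℝ) + w.1) = m := by rw [round_eq_iff]; constructor <;> linarith
  have e₂ : round ((n : ℝ) + w.2) = n := by rw [round_eq_iff]; constructor <;> linarith
  simp [center, e₁, e₂]

/-- Rounding jumps, but the squared distance to the lattice does not: it is a sum of squared norms
in the unit circle. -/
theorem continuous_nsq_cell : Continuous fun z => nsq (cell z) := by
  have h : ∀ x : ℝ, (x - round x) ^ 2 = ‖(x : UnitAddCircle)‖ ^ 2 := fun x => by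
    rw [UnitAddCircle.norm_eq, sq_abs]
  have hc : Continuous fun x : ℝ => (x : UnitAddCircle) := AddCircle.continuous_mk' 1
  have : (fun z => nsq (cell z)) =
      fun z : ℝ × ℝ => ‖(z.1 : UnitAddCircle)‖ ^ 2 + ‖(z.2 : UnitAddCircle)‖ ^ 2 := by
    funext z; simp only [nsq, cell, h]
  rw [this]
  exact ((hc.comp continuous_fst).norm.pow 2).add ((hc.comp continuous_snd).norm.pow 2)

theorem center_eventuallyEq {z : ℝ × ℝ} (h : nsq (cell z) < 1 / 4) :
    ∀ᶠ y in nhds z, center y = center z := by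
  have hc : ContinuousAt (fun y => y - center z) z := by fun_prop
  have ho : IsOpen {w : ℝ × ℝ | |w.1| < 1 / 2 ∧ |w.2| < 1 / 2} :=
    (isOpen_lt continuous_fst.abs continuous_const).inter
      (isOpen_lt continuous_snd.abs continuous_const)
  filter_upwards [hc.eventually (ho.mem_nhds (abs_lt_half_of_nsq h))] with y hy
  have := center_add_of_abs_lt (ℓ := center z) rfl hy.1 hy.2
  simpa using this

theorem cell_eventuallyEq {z : ℝ × ℝ} (h : nsq (cell z) < 1 / 4) :
    ∀ᶠ y in nhds z, cell y = y - center z := by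
  filter_upwards [center_eventuallyEq h] with y hy
  rw [cell_eq, hy]

/-- The periodization of a function supported near the origin is smooth. -/
theorem contDiffAt_comp_cell {F : Type*} [NormedAddCommGroup F] [NormedSpace ℝ F]
    {g : ℝ × ℝ → F} {z : ℝ × ℝ} (hg : ContDiffAt ℝ ∞ g (cell z))
    (h₀ : ∀ w, 17 / 72 < nsq w → g w = 0) : ContDiffAt ℝ ∞ (fun z => g (cell z)) z := by
  -- Below `1/4` the rounding is locally constant. From `1/4` on, nearby values exceed `17/72` and
  -- the function vanishes there.
  rcases lt_or_ge (nsq (cell z)) (1 / 4) with h | h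
  · have : ContDiffAt ℝ ∞ (fun y => g (y - center z)) z :=
      ContDiffAt.comp z hg (by fun_prop : ContDiffAt ℝ ∞ (fun y => y - center z) z)
    refine this.congr_of_eventuallyEq ?_
    filter_upwards [cell_eventuallyEq h] with y hy
    rw [hy]
  · refine (contDiffAt_const (c := (0 : F))).congr_of_eventuallyEq ?_
    filter_upwards [continuous_nsq_cell.continuousAt.eventually
      (lt_mem_nhds (show 17 / 72 < nsq (cell z) by linarith))] with y hy
    exact h₀ _ hy

/-- The factor of the radial map that opens the origin to a disc. -/
def radFactor (s : ℝ) : ℝ := Real.sqrt (blow s / s)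

theorem radFactor_sq {s : ℝ} (hs : 0 < s) : s * radFactor s ^ 2 = blow s := by
  rw [radFactor, Real.sq_sqrt (div_nonneg (blow_pos hs.le).le hs.le)]
  field_simp

theorem radFactor_pos {s : ℝ} (hs : 0 < s) : 0 < radFactor s :=
  Real.sqrt_pos.2 (div_pos (blow_pos hs.le) hs)

theorem contDiffAt_radFactor {s : ℝ} (hs : 0 < s) : ContDiffAt ℝ ∞ radFactor s :=
  (contDiff_blow.contDiffAt.div contDiffAt_id hs.ne').sqrt (div_pos (blow_pos hs.le) hs).ne'

theorem radFactor_of_ge {s : ℝ} (hs : 17 / 72 ≤ s) : radFactor s = 1 := by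
  rw [radFactor, blow_of_ge hs, div_self (by linarith), Real.sqrt_one]

/-- The map of the plane that opens every integral point to a disc of radius `√2 / 3`. -/
def rad (z : ℝ × ℝ) : ℝ × ℝ := z + (radFactor (nsq (cell z)) - 1) • cell z

theorem rad_eq (z : ℝ × ℝ) : rad z = center z + radFactor (nsq (cell z)) • cell z := by
  rw [rad, sub_smul, one_smul, cell_eq]; abel

theorem rad_of_ge {z : ℝ × ℝ} (h : 17 / 72 ≤ nsq (cell z)) : rad z = z := by
  rw [rad, radFactor_of_ge h]; simp

theorem nsq_smul (a : ℝ) (w : ℝ × ℝ) : nsq (a • w) = a ^ 2 * nsq w := by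
  simp [nsq]; ring

theorem nsq_nonneg (w : ℝ × ℝ) : 0 ≤ nsq w := by unfold nsq; positivity

/-- As `blow` is increasing and fixes `17/72 < 1/4`, a point near a lattice point is moved within
the disc of radius `1/2` around it. -/
theorem center_rad {z : ℝ × ℝ} (h : 0 < nsq (cell z)) : center (rad z) = center z := by
  rcases le_or_gt (17 / 72) (nsq (cell z)) with h' | h'
  · rw [rad_of_ge h']
  · have : nsq (radFactor (nsq (cell z)) • cell z) < 1 / 4 := by
      rw [nsq_smul, mul_comm, radFactor_sq h]
      have := strictMono_blow h'
      rw [blow_of_ge le_rfl] at this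
      linarith
    have := abs_lt_half_of_nsq this
    rw [rad_eq]
    exact center_add_of_abs_lt rfl this.1 this.2

theorem cell_rad {z : ℝ × ℝ} (h : 0 < nsq (cell z)) :
    cell (rad z) = radFactor (nsq (cell z)) • cell z := by
  rw [cell_eq, center_rad h, rad_eq]; simp

theorem nsq_cell_rad {z : ℝ × ℝ} (h : 0 < nsq (cell z)) :
    nsq (cell (rad z)) = blow (nsq (cell z)) := by
  rw [cell_rad h, nsq_smul, mul_comm, radFactor_sq h]

theorem two_ninths_lt_nsq_cell_rad {z : ℝ × ℝ} (h : 0 < nsq (cell z)) :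
    2 / 9 < nsq (cell (rad z)) := by
  rw [nsq_cell_rad h, ← blow_zero]
  exact strictMono_blow h

theorem rad_injOn {z z' : ℝ × ℝ} (h : 0 < nsq (cell z)) (h' : 0 < nsq (cell z'))
    (e : rad z = rad z') : z = z' := by
  have e₁ : center z = center z' := by rw [← center_rad h, ← center_rad h', e]
  have e₂ : nsq (cell z) = nsq (cell z') :=
    strictMono_blow.injective (by rw [← nsq_cell_rad h, ← nsq_cell_rad h', e])
  have e₃ : cell z = cell z' := by
    have := cell_rad h
    rw [e, cell_rad h', e₂] at this
    exact smul_right_injective _ (radFactor_pos h').ne' this.symm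
  rw [cell_eq, cell_eq, e₁] at e₃
  exact sub_left_injective e₃

theorem contDiffAt_nsq (w : ℝ × ℝ) : ContDiffAt ℝ ∞ nsq w := by unfold nsq; fun_prop

theorem contDiffAt_rad {z : ℝ × ℝ} (h : 0 < nsq (cell z)) : ContDiffAt ℝ ∞ rad z := by
  refine contDiffAt_id.add
    (contDiffAt_comp_cell (g := fun w => (radFactor (nsq w) - 1) • w) ?_ fun w hw => ?_)
  · have : ContDiffAt ℝ ∞ (fun w => radFactor (nsq w)) (cell z) :=
      (contDiffAt_radFactor h).comp _ (contDiffAt_nsq _)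
    fun_prop
  · simp [radFactor_of_ge hw.le]

/-- The Jacobian of a radial map of the plane is the derivative of the new squared norm with respect
to the old one. -/
theorem hasJacobianAt_rad {z : ℝ × ℝ} (h : 0 < nsq (cell z)) :
    HasJacobianAt rad (deriv blow (nsq (cell z))) z := by
  rcases lt_or_ge (nsq (cell z)) (1 / 4) with h' | h'
  · have hd : HasDerivAt radFactor (deriv radFactor (nsq (cell z))) (nsq (cell z)) :=
      ((contDiffAt_radFactor h).differentiableAt (by simp)).hasDerivAt
    have hb : deriv blow (nsq (cell z)) = radFactor (nsq (cell z)) ^ 2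
        + 2 * nsq (cell z) * radFactor (nsq (cell z)) * deriv radFactor (nsq (cell z)) := by
      have e : blow =ᶠ[nhds (nsq (cell z))] fun s => s * radFactor s ^ 2 := by
        filter_upwards [lt_mem_nhds h] with s hs
        exact (radFactor_sq hs).symm
      have h₂ : HasDerivAt (fun s => s * radFactor s ^ 2) _ (nsq (cell z)) :=
        (hasDerivAt_id _).mul (hd.pow 2)
      rw [e.deriv_eq, h₂.deriv]
      simp; ring
    have hr := hasJacobianAt_radial (w := cell z) hd
    have ht := hasJacobianAt_add_const (-center z) z
    have := (hasJacobianAt_add_const (center z) _).comp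
      (HasJacobianAt.comp (f := fun y => y + -center z) hr ht)
    rw [hb]
    have key := this.congr (g := rad) ?_
    · simpa [nsq] using key
    · filter_upwards [cell_eventuallyEq h', center_eventuallyEq h'] with y hy hy'
      rw [rad_eq, hy, hy']
      simp only [Function.comp, ← sub_eq_add_neg, nsq]
      rw [add_comm]; rfl
  · have e : rad =ᶠ[nhds z] fun y => y + 0 := by
      filter_upwards [continuous_nsq_cell.continuousAt.eventually
        (lt_mem_nhds (show 17 / 72 < nsq (cell z) by linarith))] with y hy
      rw [rad_of_ge hy.le, add_zero]
    have hb : deriv blow (nsq (cell z)) = 1 := by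
      have := deriv_opened_mul_deriv_blow (nsq (cell z))
      rwa [blow_of_ge (by linarith), deriv_opened_of_gt (by linarith), one_mul] at this
    rw [hb]
    exact (hasJacobianAt_add_const 0 z).congr e

/-- The density of the area form that `rad` transports from the standard one. -/
def density (z : ℝ × ℝ) : ℝ := deriv opened (nsq (cell z))

theorem contDiff_density : ContDiff ℝ ∞ density := by
  rw [contDiff_iff_contDiffAt]
  intro z
  have h : ContDiffAt ℝ ∞ (fun z => deriv opened (nsq (cell z)) - 1) z := by
    refine contDiffAt_comp_cell (g := fun w => deriv opened (nsq w) - 1) ?_ fun w hw => ?_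
    · exact (((contDiff_infty_iff_deriv.1 contDiff_opened).2.contDiffAt).comp _
        (contDiffAt_nsq _)).sub contDiffAt_const
    · rw [deriv_opened_of_gt hw, sub_self]
  have := h.add (contDiffAt_const (c := (1 : ℝ)))
  simp only [sub_add_cancel] at this
  exact this

theorem density_pos (z : ℝ × ℝ) : 0 < density z :=
  zero_lt_one.trans_le (one_le_deriv_opened _)

/-- Since `opened` and `blow` are inverse to each other, `rad` pulls `density` times the area form
back to the standard area form. -/
theorem density_rad_mul {z : ℝ × ℝ} (h : 0 < nsq (cell z)) :
    density (rad z) * deriv blow (nsq (cell z)) = 1 := by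
  rw [density, nsq_cell_rad h, deriv_opened_mul_deriv_blow]

theorem cell_add_int (z : ℝ × ℝ) (m n : ℤ) : cell (z + ((m : ℝ), (n : ℝ))) = cell z := by
  simp [cell]

theorem rad_add_int (z : ℝ × ℝ) (m n : ℤ) :
    rad (z + ((m : ℝ), (n : ℝ))) = rad z + ((m : ℝ), (n : ℝ)) := by
  rw [rad, rad, cell_add_int]; abel

theorem density_add_int (z : ℝ × ℝ) (m n : ℤ) : density (z + ((m : ℝ), (n : ℝ))) = density z := by
  rw [density, density, cell_add_int]

theorem density_swap (x y : ℝ) : density (x, y) = density (y, x) := by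
  simp [density, cell, nsq, add_comm]

/-! ### Straightening the density -/

/-- `density` in the coordinates `p = x + y`, `s = y - x`. -/
def slantDensity (w : ℝ × ℝ) : ℝ := density ((w.1 - w.2) / 2, (w.1 + w.2) / 2)

theorem contDiff_slantDensity : ContDiff ℝ ∞ slantDensity :=
  contDiff_density.comp (by fun_prop)

theorem slantDensity_pos (w : ℝ × ℝ) : 0 < slantDensity w := density_pos _

theorem slantDensity_add_one (p s : ℝ) : slantDensity (p + 1, s + 1) = slantDensity (p, s) := by
  have := density_add_int ((p - s) / 2, (p + s) / 2) 0 1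
  rw [slantDensity, slantDensity, ← this]
  congr 1
  ext <;> simp
  ring

theorem slantDensity_add_two (p s : ℝ) : slantDensity (p + 2, s) = slantDensity (p, s) := by
  have := density_add_int ((p - s) / 2, (p + s) / 2) 1 1
  rw [slantDensity, slantDensity, ← this]
  congr 1
  ext <;> simp <;> ring

/-- Reflection in the diagonal. It makes the integrals over the two segments that meet at `s = 0`
equal, and so gives `total` the period 1 instead of 2: both strands over a point of the annulus are
equally thick. -/
theorem slantDensity_neg (p s : ℝ) : slantDensity (p, -s) = slantDensity (p, s) := by
  rw [slantDensity, slantDensity, density_swap]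
  simp [sub_eq_add_neg]

/-- The integral of the density along a vertical segment. -/
def height (w : ℝ × ℝ) : ℝ := ∫ s in (0 : ℝ)..w.2, slantDensity (w.1, s)

/-- The integral of the density over a period. -/
def total (q : ℝ) : ℝ := height (q, 1)

theorem contDiff_height : ContDiff ℝ ∞ height := contDiff_primitive_snd contDiff_slantDensity

theorem contDiff_total : ContDiff ℝ ∞ total := contDiff_height.comp (by fun_prop)

theorem continuous_slantDensity_right (q : ℝ) : Continuous fun s => slantDensity (q, s) :=
  contDiff_slantDensity.continuous.comp (by fun_prop)

theorem intervalIntegrable_slantDensity (q a b : ℝ) :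
    IntervalIntegrable (fun s => slantDensity (q, s)) MeasureTheory.volume a b :=
  (continuous_slantDensity_right q).intervalIntegrable a b

theorem hasDerivAt_height (q v : ℝ) :
    HasDerivAt (fun v => height (q, v)) (slantDensity (q, v)) v :=
  intervalIntegral.integral_hasDerivAt_right (intervalIntegrable_slantDensity q 0 v)
    ((continuous_slantDensity_right q).stronglyMeasurableAtFilter _ _)
    (continuous_slantDensity_right q).continuousAt

theorem height_strictMono (q : ℝ) : StrictMono fun v => height (q, v) :=
  strictMono_of_deriv_pos fun v => by
    rw [(hasDerivAt_height q v).deriv]; exact slantDensity_pos _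

theorem height_zero (q : ℝ) : height (q, 0) = 0 := by simp [height]

theorem height_nonneg (q : ℝ) {v : ℝ} (hv : 0 ≤ v) : 0 ≤ height (q, v) := by
  rw [← height_zero q]; exact (height_strictMono q).monotone hv

theorem height_lt_total (q : ℝ) {v : ℝ} (hv : v < 1) : height (q, v) < total q :=
  height_strictMono q hv

theorem total_pos (q : ℝ) : 0 < total q := by
  have := height_lt_total q zero_lt_one
  rwa [height_zero] at this

theorem height_neg_one (q : ℝ) : height (q, -1) = - total q := by
  have := intervalIntegral.integral_comp_neg (a := 0) (b := 1) fun s => slantDensity (q, s)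
  simp only [slantDensity_neg, neg_zero] at this
  simp only [total, height]
  rw [this, intervalIntegral.integral_symm]

/-- By diagonal translation the left side is the integral at `q` from `-1` to `v`. The extra `total
q` is what the difference of levels makes up for at a window. -/
theorem height_add_one (q v : ℝ) : height (q + 1, v + 1) = height (q, v) + total q := by
  have h := intervalIntegral.integral_comp_add_right (a := -1) (b := v)
    (fun s => slantDensity (q + 1, s)) 1
  simp only [slantDensity_add_one, neg_add_cancel] at h
  have h' := intervalIntegral.integral_add_adjacent_intervals
    (intervalIntegrable_slantDensity q (-1) 0) (intervalIntegrable_slantDensity q 0 v)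
  have h'' := height_neg_one q
  rw [height, intervalIntegral.integral_symm] at h''
  simp only [height] at *
  linarith

theorem height_add_two (q v : ℝ) : height (q + 2, v) = height (q, v) := by
  simp only [height, slantDensity_add_two]

theorem total_periodic : Function.Periodic total 1 := fun q => by
  have := height_add_one q 0
  rw [height_zero, zero_add, zero_add] at this
  exact this

theorem exists_total_le : ∃ C, ∀ q, total q ≤ C := by
  obtain ⟨C, hC⟩ := isCompact_Icc (a := (0 : ℝ)) (b := 1) |>.exists_bound_of_continuousOn
    contDiff_total.continuous.continuousOn
  refine ⟨C, fun q => ?_⟩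
  have h : total q = total (Int.fract q) := by
    have := total_periodic.sub_int_mul_eq (x := q) ⌊q⌋
    rw [mul_one] at this
    rw [← this]; rfl
  rw [h]
  exact (Real.le_norm_self _).trans (hC _ ⟨Int.fract_nonneg q, (Int.fract_lt_one q).le⟩)

theorem hasJacobianAt_height (w : ℝ × ℝ) :
    HasJacobianAt (fun w => (w.1, height w)) (slantDensity w) w := by
  have h : HasFDerivAt height (fderiv ℝ height w) w :=
    (contDiff_height.differentiable (by simp) w).hasFDerivAt
  have h₁ : HasFDerivAt (fun w : ℝ × ℝ => w.1) (ContinuousLinearMap.fst ℝ ℝ ℝ) w := hasFDerivAt_fst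
  refine ⟨_, h₁.prodMk h, fun u v => ?_⟩
  -- The other partial derivative drops out of the determinant, because the first coordinate is
  -- preserved.
  have h₂ : fderiv ℝ height w (0, 1) = slantDensity w :=
    HasDerivAt.unique (HasFDerivAt.comp_hasDerivAt (f := fun v => (w.1, v)) w.2 h
      ((hasDerivAt_const w.2 w.1).prodMk (hasDerivAt_id w.2))) (hasDerivAt_height w.1 w.2)
  have h₃ : ∀ u : ℝ × ℝ, fderiv ℝ height w u
      = u.1 * fderiv ℝ height w (1, 0) + u.2 * slantDensity w := fun u => by
    rw [← h₂, ← smul_eq_mul, ← smul_eq_mul, ← map_smul, ← map_smul, ← map_add]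
    simp
  simp only [area, ContinuousLinearMap.prod_apply, ContinuousLinearMap.coe_fst']
  rw [h₃ u, h₃ v]
  ring

/-! ### The coordinates on a strip -/

/-- The coordinates `x + y` and `y - x`. -/
def slant (z : ℝ × ℝ) : ℝ × ℝ := (z.1 + z.2, z.2 - z.1)

/-- Translation along the diagonal into the strip `ℝ × [0, 1)`. -/
def toStrip (w : ℝ × ℝ) : ℝ × ℝ := (w.1 - ⌊w.2⌋, w.2 - ⌊w.2⌋)

/-- The strip coordinates of a point of the plane with the lattice points opened. -/
def stripCoord (z : ℝ × ℝ) : ℝ × ℝ := toStrip (slant (rad z))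

theorem hasJacobianAt_slant (z : ℝ × ℝ) : HasJacobianAt slant 2 z := by
  have h₁ : HasFDerivAt (fun w : ℝ × ℝ => w.1) (ContinuousLinearMap.fst ℝ ℝ ℝ) z := hasFDerivAt_fst
  have h₂ : HasFDerivAt (fun w : ℝ × ℝ => w.2) (ContinuousLinearMap.snd ℝ ℝ ℝ) z := hasFDerivAt_snd
  refine ⟨_, (h₁.add h₂).prodMk (h₂.sub h₁), fun u v => ?_⟩
  simp [area]; ring

theorem slantDensity_slant (z : ℝ × ℝ) : slantDensity (slant z) = density z := by
  rw [slantDensity]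
  congr 1
  ext <;> simp [slant] <;> ring

theorem slantDensity_sub_int (w : ℝ × ℝ) (n : ℤ) :
    slantDensity (w - ((n : ℝ), (n : ℝ))) = slantDensity w := by
  have := density_add_int ((w.1 - w.2) / 2, (w.1 + w.2) / 2) 0 (-n)
  rw [slantDensity, slantDensity, ← this]
  congr 1
  ext <;> simp
  ring

/-- On each diagonal translate of the strip, the opened plane has coordinates in which the area
form is constant. -/
theorem hasJacobianAt_stripMap {z : ℝ × ℝ} (h : 0 < nsq (cell z)) (n : ℤ) :
    HasJacobianAt (fun z => let w := slant (rad z) - ((n : ℝ), (n : ℝ)); (w.1, height w)) 2 z := by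
  have h₁ := hasJacobianAt_rad h
  have h₂ := (hasJacobianAt_slant (rad z)).comp h₁
  have h₃ := HasJacobianAt.comp (f := slant ∘ rad)
    (hasJacobianAt_add_const (-((n : ℝ), (n : ℝ))) (slant (rad z))) h₂
  have h₄ := (hasJacobianAt_height _).comp h₃
  simp only [Function.comp, ← sub_eq_add_neg, slantDensity_sub_int, slantDensity_slant] at h₄
  have := density_rad_mul h
  -- The factor 2 is the determinant of `slant`; `offset` compensates it by `ε / 2`.
  have e : density (rad z) * (1 * (2 * deriv blow (nsq (cell z)))) = 2 := by
    linear_combination 2 * this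
  rw [e] at h₄
  exact h₄

/-- A point of the opened plane on the boundary of a strip lies between two holes. -/
theorem stripCoord_window {z : ℝ × ℝ} (h : 0 < nsq (cell z)) (hv : (stripCoord z).2 = 0) :
    ∃ j : ℤ, |(stripCoord z).1 - (2 * j + 1)| < 1 / 3 := by
  have h' := two_ninths_lt_nsq_cell_rad h
  simp only [stripCoord, toStrip, slant] at hv ⊢
  obtain ⟨x, y, hxy⟩ : ∃ x y, rad z = (x, y) := ⟨_, _, rfl⟩
  simp only [hxy, nsq, cell] at h' hv ⊢
  set n := ⌊y - x⌋
  obtain ⟨hx₁, hx₂⟩ := abs_le.1 (abs_sub_round x)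
  obtain ⟨hy₁, hy₂⟩ := abs_le.1 (abs_sub_round y)
  set a := x - round x with ha
  set b := y - round y with hb
  have hk : b - a = ((n - round y + round x : ℤ) : ℝ) := by push_cast; linarith
  obtain ⟨k, hkdef⟩ : ∃ k : ℤ, k = n - round y + round x := ⟨_, rfl⟩
  rw [← hkdef] at hk
  have hn : (n : ℝ) = k + round y - round x := by rw [hkdef]; push_cast; ring
  have k₁ : -1 ≤ k := by
    have : (-1 : ℝ) ≤ k := by rw [← hk]; linarith
    exact_mod_cast this
  have k₂ : k ≤ 1 := by
    have : (k : ℝ) ≤ 1 := by rw [← hk]; linarith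
    exact_mod_cast this
  have hq : x + y - n = 2 * round x + (a + b - k) := by rw [hn]; simp only [ha, hb]; ring
  rw [hq]
  clear hkdef
  -- Both remainders are at most `1/2` in absolute value. For `k = ±1` they are opposite halves, a
  -- corner of the cell. For `k = 0` the point lies on the diagonal, where avoiding the hole means
  -- `|a| > 1/3`.
  obtain rfl | rfl | rfl : k = -1 ∨ k = 0 ∨ k = 1 := by omega
  · refine ⟨round x, ?_⟩
    push_cast at hk ⊢
    rw [abs_lt]; constructor <;> linarith
  · push_cast at hk ⊢
    have hab : b = a := by linarith
    rw [hab] at h' ⊢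
    have ha2 : (1 / 3) ^ 2 < a ^ 2 := by linarith
    rcases le_total 0 a with h0 | h0
    · have : 1 / 3 < a := lt_of_pow_lt_pow_left₀ 2 h0 ha2
      refine ⟨round x, ?_⟩
      rw [abs_lt]; constructor <;> linarith
    · have : 1 / 3 < -a := lt_of_pow_lt_pow_left₀ 2 (by linarith) (by rw [neg_sq]; exact ha2)
      refine ⟨round x - 1, ?_⟩
      push_cast
      rw [abs_lt]; constructor <;> linarith
  · refine ⟨round x - 1, ?_⟩
    push_cast at hk ⊢
    rw [abs_lt]; constructor <;> linarith

theorem toStrip_snd_mem (w : ℝ × ℝ) : (toStrip w).2 ∈ Set.Ico (0 : ℝ) 1 :=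
  ⟨by simp only [toStrip]; linarith [Int.floor_le w.2],
    by simp only [toStrip]; linarith [Int.lt_floor_add_one w.2]⟩

/-- Points with the same strip coordinates up to an even translation differ by a lattice vector. -/
theorem exists_int_of_stripCoord {z z' : ℝ × ℝ} (h : 0 < nsq (cell z)) (h' : 0 < nsq (cell z'))
    {k : ℤ} (e₁ : (stripCoord z').1 = (stripCoord z).1 + 2 * k)
    (e₂ : (stripCoord z').2 = (stripCoord z).2) :
    ∃ m n : ℤ, z' = z + ((m : ℝ), (n : ℝ)) := by
  simp only [stripCoord, toStrip, slant] at e₁ e₂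
  set i := ⌊(rad z).2 - (rad z).1⌋
  set i' := ⌊(rad z').2 - (rad z').1⌋
  -- The vector `(m, n)` shifts the slanted coordinates by `(m + n, n - m)`, which has to be `(2k +
  -- i' - i, i' - i)`.
  refine ⟨k, k + i' - i, rad_injOn h' (by rwa [cell_add_int]) ?_⟩
  rw [rad_add_int]
  ext
  · simp; linarith
  · simp; linarith

theorem stripCoord_add_int (z : ℝ × ℝ) (m n : ℤ) :
    stripCoord (z + ((m : ℝ), (n : ℝ))) = stripCoord z + (2 * (m : ℝ), 0) := by
  simp only [stripCoord, rad_add_int, toStrip, slant]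
  have : ⌊((rad z + ((m : ℝ), (n : ℝ))).2 - (rad z + ((m : ℝ), (n : ℝ))).1)⌋
      = ⌊(rad z).2 - (rad z).1⌋ + (n - m) := by
    rw [← Int.floor_add_intCast]; congr 1; simp; ring
  rw [this]
  ext
  · simp; ring
  · simp only [Prod.snd_add, Prod.fst_add]; push_cast; ring

/-! ### Polar coordinates and the disc -/

/-- Symplectic polar coordinates. -/
def polar (w : ℝ × ℝ) : ℝ × ℝ :=
  (Real.sqrt (2 * w.2) * Real.sin w.1, Real.sqrt (2 * w.2) * Real.cos w.1)

theorem polar_add_two_pi (t s : ℝ) (k : ℤ) : polar (t + 2 * Real.pi * k, s) = polar (t, s) := by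
  have h₁ := Real.sin_add_int_mul_two_pi t k
  have h₂ := Real.cos_add_int_mul_two_pi t k
  simp only [polar]
  rw [show t + 2 * Real.pi * k = t + k * (2 * Real.pi) by ring, h₁, h₂]

theorem nsq_polar (t : ℝ) {s : ℝ} (hs : 0 ≤ s) : nsq (polar (t, s)) = 2 * s := by
  have := Real.sq_sqrt (show 0 ≤ 2 * s by linarith)
  simp only [nsq, polar, mul_pow, this]
  linear_combination (2 * s) * Real.sin_sq_add_cos_sq t

theorem polar_inj {t s t' s' : ℝ} (hs : 0 < s) (hs' : 0 < s')
    (h : polar (t, s) = polar (t', s')) : s = s' ∧ ∃ k : ℤ, t' = t + 2 * Real.pi * k := by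
  have e : s = s' := by
    have := congrArg nsq h
    rw [nsq_polar t hs.le, nsq_polar t' hs'.le] at this
    linarith
  subst e
  refine ⟨rfl, ?_⟩
  have hp : Real.sqrt (2 * s) ≠ 0 := (Real.sqrt_pos.2 (by linarith)).ne'
  simp only [polar, Prod.mk.injEq, mul_right_inj' hp] at h
  obtain ⟨k, hk⟩ := Real.Angle.angle_eq_iff_two_pi_dvd_sub.1
    (Real.Angle.cos_sin_inj h.2.symm h.1.symm)
  exact ⟨k, by linarith⟩

theorem contDiffAt_polar {w : ℝ × ℝ} (h : 0 < w.2) : ContDiffAt ℝ ∞ polar w := by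
  have h₀ : ContDiffAt ℝ ∞ (fun w : ℝ × ℝ => 2 * w.2) w := by fun_prop
  have h₁ : ContDiffAt ℝ ∞ (fun w : ℝ × ℝ => Real.sqrt (2 * w.2)) w := h₀.sqrt (by linarith)
  have h₂ : ContDiffAt ℝ ∞ (fun w : ℝ × ℝ => Real.sin w.1) w := contDiffAt_fst.sin
  have h₃ : ContDiffAt ℝ ∞ (fun w : ℝ × ℝ => Real.cos w.1) w := contDiffAt_fst.cos
  exact (h₁.mul h₂).prodMk (h₁.mul h₃)

/-- With the sine first, the order angle, action is positively oriented. -/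
theorem hasJacobianAt_polar {w : ℝ × ℝ} (h : 0 < w.2) : HasJacobianAt polar 1 w := by
  have h₁ : HasFDerivAt (fun w : ℝ × ℝ => w.1) (ContinuousLinearMap.fst ℝ ℝ ℝ) w := hasFDerivAt_fst
  have h₂ : HasFDerivAt (fun w : ℝ × ℝ => w.2) (ContinuousLinearMap.snd ℝ ℝ ℝ) w := hasFDerivAt_snd
  have h₃ := (h₂.const_mul 2).sqrt (by linarith)
  refine ⟨_, (h₃.mul h₁.sin).prodMk (h₃.mul h₁.cos), fun u v => ?_⟩
  have hs : 0 < Real.sqrt (2 * w.2) := Real.sqrt_pos.2 (by linarith)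
  have hs2 := Real.sq_sqrt (show 0 ≤ 2 * w.2 by linarith)
  have hc : Real.sin w.1 ^ 2 = 1 - Real.cos w.1 ^ 2 := Real.sin_sq w.1
  simp [area]
  field_simp
  ring_nf
  simp only [hc]
  ring

/-- The first coordinate of an area preserving map from the unit disc to a rectangle. -/
def discAngle (x : ℝ) : ℝ := Real.arcsin x + x * Real.sqrt (1 - x ^ 2) + Real.pi / 2

/-- An area preserving map from the unit disc to the rectangle `(0, π) × (0, 1)`. -/
def discToRect (b : ℝ × ℝ) : ℝ × ℝ :=
  (discAngle b.1, b.2 / (2 * Real.sqrt (1 - b.1 ^ 2)) + 1 / 2)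

theorem one_sub_sq_pos_of_nsq_lt {b : ℝ × ℝ} (hb : nsq b < 1) : 0 < 1 - b.1 ^ 2 := by
  unfold nsq at hb; nlinarith [sq_nonneg b.2]

/-- `discAngle x` is the area of the part of the unit disc to the left of `x`, and its derivative is
the length of the chord at `x`. -/
theorem hasDerivAt_discAngle {x : ℝ} (hx : 0 < 1 - x ^ 2) :
    HasDerivAt discAngle (2 * Real.sqrt (1 - x ^ 2)) x := by
  have h₁ : HasDerivAt Real.arcsin (1 / Real.sqrt (1 - x ^ 2)) x :=
    Real.hasDerivAt_arcsin (by rintro rfl; norm_num at hx) (by rintro rfl; norm_num at hx)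
  have h₂ : HasDerivAt (fun x : ℝ => 1 - x ^ 2) (-(2 * x)) x := by
    simpa using (hasDerivAt_pow 2 x).const_sub 1
  have h₃ := h₂.sqrt hx.ne'
  have h₄ := (h₁.add ((hasDerivAt_id x).mul h₃)).add_const (Real.pi / 2)
  refine HasDerivAt.congr_deriv (f := discAngle) h₄ ?_
  have hs : 0 < Real.sqrt (1 - x ^ 2) := Real.sqrt_pos.2 hx
  have hs2 := Real.sq_sqrt hx.le
  simp
  field_simp
  rw [hs2]; ring

theorem continuous_discAngle : Continuous discAngle := by
  have := Real.continuous_arcsin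
  unfold discAngle; fun_prop

theorem strictMonoOn_discAngle : StrictMonoOn discAngle (Set.Icc (-1) 1) := by
  refine strictMonoOn_of_deriv_pos (convex_Icc _ _) continuous_discAngle.continuousOn fun x hx => ?_
  rw [interior_Icc] at hx
  have : 0 < 1 - x ^ 2 := by nlinarith [hx.1, hx.2]
  rw [(hasDerivAt_discAngle this).deriv]
  have := Real.sqrt_pos.2 this
  positivity

theorem mem_Ioo_of_one_sub_sq_pos {x : ℝ} (hx : 0 < 1 - x ^ 2) : x ∈ Set.Ioo (-1 : ℝ) 1 := by
  constructor <;> nlinarith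

theorem discAngle_mem {x : ℝ} (hx : 0 < 1 - x ^ 2) : discAngle x ∈ Set.Ioo 0 Real.pi := by
  have h := mem_Ioo_of_one_sub_sq_pos hx
  have h₁ := strictMonoOn_discAngle (by norm_num) ⟨h.1.le, h.2.le⟩ h.1
  have h₂ := strictMonoOn_discAngle ⟨h.1.le, h.2.le⟩ (by norm_num) h.2
  have e₁ : discAngle (-1) = 0 := by simp [discAngle]
  have e₂ : discAngle 1 = Real.pi := by simp [discAngle]
  rw [e₁] at h₁
  rw [e₂] at h₂
  exact ⟨h₁, h₂⟩

theorem discToRect_mem {b : ℝ × ℝ} (hb : nsq b < 1) :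
    (discToRect b).1 ∈ Set.Ioo 0 Real.pi ∧ (discToRect b).2 ∈ Set.Ioo (0 : ℝ) 1 := by
  have hx := one_sub_sq_pos_of_nsq_lt hb
  refine ⟨discAngle_mem hx, ?_⟩
  have hs : 0 < Real.sqrt (1 - b.1 ^ 2) := Real.sqrt_pos.2 hx
  have hs2 := Real.sq_sqrt hx.le
  have habs : |b.2| < Real.sqrt (1 - b.1 ^ 2) := by
    apply abs_lt_of_sq_lt_sq _ hs.le
    rw [hs2]; unfold nsq at hb; linarith
  rw [abs_lt] at habs
  have h₁ : -(1 / 2) < b.2 / (2 * Real.sqrt (1 - b.1 ^ 2)) := by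
    rw [lt_div_iff₀ (by positivity)]; linarith
  have h₂ : b.2 / (2 * Real.sqrt (1 - b.1 ^ 2)) < 1 / 2 := by
    rw [div_lt_iff₀ (by positivity)]; linarith
  constructor <;> simp only [discToRect] <;> linarith

theorem discToRect_inj {b b' : ℝ × ℝ} (hb : nsq b < 1) (hb' : nsq b' < 1)
    (h : discToRect b = discToRect b') : b = b' := by
  have hx := one_sub_sq_pos_of_nsq_lt hb
  have hx' := one_sub_sq_pos_of_nsq_lt hb'
  simp only [discToRect, Prod.mk.injEq] at h
  have e := strictMonoOn_discAngle.injOn (Set.Ioo_subset_Icc_self (mem_Ioo_of_one_sub_sq_pos hx))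
    (Set.Ioo_subset_Icc_self (mem_Ioo_of_one_sub_sq_pos hx')) h.1
  refine Prod.ext e ?_
  have h₂ := h.2
  rw [← e] at h₂
  have hs : 2 * Real.sqrt (1 - b.1 ^ 2) ≠ 0 := (mul_pos two_pos (Real.sqrt_pos.2 hx)).ne'
  have := add_right_cancel h₂
  rwa [div_left_inj' hs] at this

theorem contDiffAt_discToRect {b : ℝ × ℝ} (hb : nsq b < 1) : ContDiffAt ℝ ∞ discToRect b := by
  have hx := one_sub_sq_pos_of_nsq_lt hb
  have h₁ : ContDiffAt ℝ ∞ Real.arcsin b.1 :=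
    Real.contDiffAt_arcsin (by intro h; rw [h] at hx; norm_num at hx)
      (by intro h; rw [h] at hx; norm_num at hx)
  have h₂ : ContDiffAt ℝ ∞ (fun b : ℝ × ℝ => Real.arcsin b.1) b :=
    ContDiffAt.comp (g := Real.arcsin) (f := Prod.fst) b h₁ contDiffAt_fst
  have h₃ : ContDiffAt ℝ ∞ (fun b : ℝ × ℝ => 1 - b.1 ^ 2) b := by fun_prop
  have h₄ : ContDiffAt ℝ ∞ (fun b : ℝ × ℝ => Real.sqrt (1 - b.1 ^ 2)) b := h₃.sqrt hx.ne'
  have hs : 2 * Real.sqrt (1 - b.1 ^ 2) ≠ 0 := (mul_pos two_pos (Real.sqrt_pos.2 hx)).ne'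
  exact ((h₂.add (contDiffAt_fst.mul h₄)).add contDiffAt_const).prodMk
    ((contDiffAt_snd.div (contDiffAt_const.mul h₄) hs).add contDiffAt_const)

/-- Each vertical chord is scaled to length 1, which cancels the chord length coming from
`discAngle`. The derivative of the scaling factor plays no role, the matrix being triangular. -/
theorem hasJacobianAt_discToRect {b : ℝ × ℝ} (hb : nsq b < 1) :
    HasJacobianAt discToRect 1 b := by
  have hx := one_sub_sq_pos_of_nsq_lt hb
  have hs : 0 < Real.sqrt (1 - b.1 ^ 2) := Real.sqrt_pos.2 hx
  have h₁ : HasFDerivAt (fun w : ℝ × ℝ => w.1) (ContinuousLinearMap.fst ℝ ℝ ℝ) b := hasFDerivAt_fst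
  have h₂ : HasFDerivAt (fun w : ℝ × ℝ => w.2) (ContinuousLinearMap.snd ℝ ℝ ℝ) b := hasFDerivAt_snd
  have h₃ := (hasDerivAt_discAngle hx).comp_hasFDerivAt b h₁
  have h₄ : HasDerivAt (fun x : ℝ => (2 * Real.sqrt (1 - x ^ 2))⁻¹)
      (deriv (fun x : ℝ => (2 * Real.sqrt (1 - x ^ 2))⁻¹) b.1) b.1 := by
    refine DifferentiableAt.hasDerivAt ?_
    have : DifferentiableAt ℝ (fun x : ℝ => 1 - x ^ 2) b.1 := by fun_prop
    exact ((this.sqrt hx.ne').const_mul 2).inv (by positivity)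
  have h₅ := ((h₂.mul (h₄.comp_hasFDerivAt b h₁)).add_const (1 / 2))
  refine ⟨_, h₃.prodMk h₅, fun u v => ?_⟩
  simp [area]
  field_simp
  ring

/-! ### The profile functions -/

/-- A staircase with `progress (q + 1) = progress q + 1`, constant near `ℤ` and near `ℤ + 1/2`. -/
def progress (q : ℝ) : ℝ :=
  (stair (q - 9 / 24) + stair (q - 33 / 24) + stair (q - 14 / 24) + stair (q - 38 / 24)) / 2

/-- The derivative of `progress`. -/
def progressDeriv (q : ℝ) : ℝ :=
  (deriv stair (q - 9 / 24) + deriv stair (q - 33 / 24) + deriv stair (q - 14 / 24)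
    + deriv stair (q - 38 / 24)) / 2

/-- The angle by which the second factor is rotated. -/
def twist (q : ℝ) : ℝ := Real.pi * (stair (q - 33 / 24) + stair (q - 38 / 24))

/-- The derivative of `twist`. -/
def twistDeriv (q : ℝ) : ℝ := Real.pi * (deriv stair (q - 33 / 24) + deriv stair (q - 38 / 24))

/-- The extra height of the strand that passes above the rotating one. -/
def roof (q : ℝ) : ℝ := Real.pi * deriv stair (q - 14 / 24)

/-- A function of period `2` that is `0` near `2ℤ` and `1` near `2ℤ + 1`: it decides which of the
two strands lies above the other. -/
def level (q : ℝ) : ℝ := stair (q - 11 / 24) - stair (q - 35 / 24)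

theorem hasDerivAt_stair_sub (a q : ℝ) :
    HasDerivAt (fun q => stair (q - a)) (deriv stair (q - a)) q :=
  HasDerivAt.comp_sub_const q a (differentiable_stair (q - a)).hasDerivAt

theorem hasDerivAt_progress (q : ℝ) : HasDerivAt progress (progressDeriv q) q :=
  ((((hasDerivAt_stair_sub _ q).add (hasDerivAt_stair_sub _ q)).add
    (hasDerivAt_stair_sub _ q)).add (hasDerivAt_stair_sub _ q)).div_const 2

theorem hasDerivAt_twist (q : ℝ) : HasDerivAt twist (twistDeriv q) q :=
  ((hasDerivAt_stair_sub _ q).add (hasDerivAt_stair_sub _ q)).const_mul Real.pi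

theorem contDiff_progress : ContDiff ℝ ∞ progress := by
  have := contDiff_stair
  unfold progress; fun_prop

theorem contDiff_progressDeriv : ContDiff ℝ ∞ progressDeriv := by
  have := contDiff_deriv_stair
  unfold progressDeriv; fun_prop

theorem contDiff_twist : ContDiff ℝ ∞ twist := by
  have := contDiff_stair
  unfold twist; fun_prop

theorem contDiff_twistDeriv : ContDiff ℝ ∞ twistDeriv := by
  have := contDiff_deriv_stair
  unfold twistDeriv; fun_prop

theorem contDiff_roof : ContDiff ℝ ∞ roof := by
  have := contDiff_deriv_stair
  unfold roof; fun_prop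

theorem contDiff_level : ContDiff ℝ ∞ level := by
  have := contDiff_stair
  unfold level; fun_prop

theorem stair_sub_add_two (q a : ℝ) : stair (q + 2 - a) = stair (q - a) + 1 := by
  rw [← stair_add_two]; ring_nf

theorem deriv_stair_sub_add_two (q a : ℝ) : deriv stair (q + 2 - a) = deriv stair (q - a) := by
  rw [← deriv_stair_add_two (q - a)]; ring_nf

theorem progress_add_one (q : ℝ) : progress (q + 1) = progress q + 1 := by
  have h₁ := stair_sub_add_two q (33 / 24)
  have h₂ := stair_sub_add_two q (38 / 24)
  unfold progress
  rw [show q + 1 - 9 / 24 = q + 2 - 33 / 24 by ring, show q + 1 - 14 / 24 = q + 2 - 38 / 24 by ring,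
    show q + 1 - 33 / 24 = q - 9 / 24 by ring, show q + 1 - 38 / 24 = q - 14 / 24 by ring, h₁, h₂]
  ring

theorem progressDeriv_periodic : Function.Periodic progressDeriv 1 := fun q => by
  have h₁ := deriv_stair_sub_add_two q (33 / 24)
  have h₂ := deriv_stair_sub_add_two q (38 / 24)
  unfold progressDeriv
  rw [show q + 1 - 9 / 24 = q + 2 - 33 / 24 by ring, show q + 1 - 14 / 24 = q + 2 - 38 / 24 by ring,
    show q + 1 - 33 / 24 = q - 9 / 24 by ring, show q + 1 - 38 / 24 = q - 14 / 24 by ring, h₁, h₂]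
  ring

theorem twist_add_two (q : ℝ) : twist (q + 2) = twist q + 2 * Real.pi := by
  simp only [twist, stair_sub_add_two]; ring

theorem twistDeriv_periodic : Function.Periodic twistDeriv 2 := fun q => by
  simp only [twistDeriv, deriv_stair_sub_add_two]

theorem roof_periodic : Function.Periodic roof 2 := fun q => by
  simp only [roof, deriv_stair_sub_add_two]

theorem level_periodic : Function.Periodic level 2 := fun q => by
  simp only [level, stair_sub_add_two]; ring

theorem progressDeriv_nonneg (q : ℝ) : 0 ≤ progressDeriv q := by
  have := deriv_stair_nonneg
  unfold progressDeriv
  linarith [this (q - 9 / 24), this (q - 33 / 24), this (q - 14 / 24), this (q - 38 / 24)]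

theorem roof_nonneg (q : ℝ) : 0 ≤ roof q := mul_nonneg Real.pi_pos.le (deriv_stair_nonneg _)

theorem twistDeriv_nonneg (q : ℝ) : 0 ≤ twistDeriv q :=
  mul_nonneg Real.pi_pos.le (add_nonneg (deriv_stair_nonneg _) (deriv_stair_nonneg _))

/-- The steps of `roof` and `twist` are three of the four in `progress`. The fourth, at `9/24`,
keeps `progress` in pace on the strand that does not rotate. -/
theorem roof_add_twistDeriv_le (q : ℝ) : roof q + twistDeriv q ≤ 2 * Real.pi * progressDeriv q := by
  have := mul_nonneg Real.pi_pos.le (deriv_stair_nonneg (q - 9 / 24))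
  unfold roof twistDeriv progressDeriv
  linarith

theorem level_nonneg (q : ℝ) : 0 ≤ level q := by
  have := stair_mono (show q - 35 / 24 ≤ q - 11 / 24 by linarith)
  unfold level; linarith

theorem level_le_one (q : ℝ) : level q ≤ 1 := by
  have := stair_mono (show q - 11 / 24 ≤ q - 35 / 24 + 2 by linarith)
  rw [stair_add_two] at this
  unfold level; linarith

/-! ### The profiles at the windows -/

section Window

variable {j : ℤ} {q : ℝ}

/-- Modulo 1 the windows lie within `8/24` of `0`, whereas all steps of the profiles take place in
`[9/24, 15/24]`. The other window lemmas rest on the same separation. -/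
theorem level_window (h : |q - (2 * j + 1)| < 1 / 3) : level q = 1 ∧ level (q + 1) = 0 := by
  rw [abs_lt] at h
  have h₁ := stair_eq_const (j + 1) (p := q - 11 / 24) (by push_cast; linarith)
    (by push_cast; linarith)
  have h₂ := stair_eq_const j (p := q - 35 / 24) (by linarith) (by linarith)
  have h₃ := stair_eq_const (j + 1) (p := q + 1 - 11 / 24) (by push_cast; linarith)
    (by push_cast; linarith)
  have h₄ : q + 1 - 35 / 24 = q - 11 / 24 := by ring
  push_cast at h₁ h₃
  simp only [level, h₄, h₁, h₂, h₃]
  constructor <;> ring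

theorem roof_window (h : |q - (2 * j + 1)| < 1 / 3) : roof q = 0 ∧ roof (q + 1) = 0 := by
  rw [abs_lt] at h
  have h₁ := deriv_stair_eq_zero (j + 1) (p := q - 14 / 24) (by push_cast; linarith)
    (by push_cast; linarith)
  have h₂ := deriv_stair_eq_zero (j + 1) (p := q + 1 - 14 / 24) (by push_cast; linarith)
    (by push_cast; linarith)
  simp [roof, h₁, h₂]

theorem twistDeriv_window (h : |q - (2 * j + 1)| < 1 / 3) :
    twistDeriv q = 0 ∧ twistDeriv (q + 1) = 0 := by
  rw [abs_lt] at h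
  have h₁ := deriv_stair_eq_zero j (p := q - 33 / 24) (by linarith) (by linarith)
  have h₂ := deriv_stair_eq_zero j (p := q - 38 / 24) (by linarith) (by linarith)
  have h₃ := deriv_stair_eq_zero (j + 1) (p := q + 1 - 33 / 24) (by push_cast; linarith)
    (by push_cast; linarith)
  have h₄ := deriv_stair_eq_zero (j + 1) (p := q + 1 - 38 / 24) (by push_cast; linarith)
    (by push_cast; linarith)
  simp [twistDeriv, h₁, h₂, h₃, h₄]

/-- Both half turns take place between `q` and `q + 1`. -/
theorem twist_window (h : |q - (2 * j + 1)| < 1 / 3) : twist (q + 1) = twist q + 2 * Real.pi := by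
  rw [abs_lt] at h
  have h₁ := stair_eq_const j (p := q - 33 / 24) (by linarith) (by linarith)
  have h₂ := stair_eq_const j (p := q - 38 / 24) (by linarith) (by linarith)
  have h₃ := stair_eq_const (j + 1) (p := q + 1 - 33 / 24) (by push_cast; linarith)
    (by push_cast; linarith)
  have h₄ := stair_eq_const (j + 1) (p := q + 1 - 38 / 24) (by push_cast; linarith)
    (by push_cast; linarith)
  push_cast at h₃ h₄
  simp only [twist, h₁, h₂, h₃, h₄]; ring

end Window

/-! ### The two strands over one point of the annulus -/

section Strands

variable {x q q' : ℝ} {i i' : ℤ}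

/-- Before the crossing, the strand at `q'` lies above the strand at `q`. -/
theorem strands_before (hx : 0 ≤ x) (hx' : x < 11 / 24) (hq : q = x + 2 * i)
    (hq' : q' = x + 1 + 2 * i') : level q = 0 ∧ level q' = 1 ∧ roof q = 0 ∧ twistDeriv q = 0 := by
  have h₁ := stair_eq_const i (p := q - 11 / 24) (by linarith) (by linarith)
  have h₂ := stair_eq_const i (p := q - 35 / 24) (by linarith) (by linarith)
  have h₃ := stair_eq_const (i' + 1) (p := q' - 11 / 24) (by push_cast; linarith)
    (by push_cast; linarith)
  have h₄ := stair_eq_const i' (p := q' - 35 / 24) (by linarith) (by linarith)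
  have h₅ := deriv_stair_eq_zero i (p := q - 14 / 24) (by linarith) (by linarith)
  have h₆ := deriv_stair_eq_zero i (p := q - 33 / 24) (by linarith) (by linarith)
  have h₇ := deriv_stair_eq_zero i (p := q - 38 / 24) (by linarith) (by linarith)
  push_cast at h₃
  simp [level, roof, twistDeriv, h₁, h₂, h₃, h₄, h₅, h₆, h₇]

/-- At the crossing, the two strands are rotated by opposite angles. -/
theorem strands_crossing (hx : 11 / 24 ≤ x) (hx' : x ≤ 12 / 24) (hq : q = x + 2 * i)
    (hq' : q' = x + 1 + 2 * i') : ∃ k : ℤ, twist q' = twist q + Real.pi + 2 * Real.pi * k := by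
  have h₁ := stair_eq_const i (p := q - 33 / 24) (by linarith) (by linarith)
  have h₂ := stair_eq_const i (p := q - 38 / 24) (by linarith) (by linarith)
  have h₃ := stair_eq_const (i' + 1) (p := q' - 33 / 24) (by push_cast; linarith)
    (by push_cast; linarith)
  have h₄ := stair_eq_const i' (p := q' - 38 / 24) (by linarith) (by linarith)
  refine ⟨i' - i, ?_⟩
  push_cast at h₃ ⊢
  simp only [twist, h₁, h₂, h₃, h₄]; ring

/-- After the crossing, the strand at `q` lies above the strand at `q'`. -/
theorem strands_after (hx : 12 / 24 < x) (hx' : x < 1) (hq : q = x + 2 * i)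
    (hq' : q' = x + 1 + 2 * i') :
    level q = 1 ∧ level q' = 0 ∧ roof q' = 0 ∧ twistDeriv q = 0 ∧ roof q = twistDeriv q' := by
  have h₁ := stair_eq_const (i + 1) (p := q - 11 / 24) (by push_cast; linarith)
    (by push_cast; linarith)
  have h₂ := stair_eq_const i (p := q - 35 / 24) (by linarith) (by linarith)
  have h₃ := stair_eq_const (i' + 1) (p := q' - 11 / 24) (by push_cast; linarith)
    (by push_cast; linarith)
  have h₄ := stair_eq_const (i' + 1) (p := q' - 35 / 24) (by push_cast; linarith)
    (by push_cast; linarith)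
  have h₅ := deriv_stair_eq_zero (i' + 1) (p := q' - 14 / 24) (by push_cast; linarith)
    (by push_cast; linarith)
  have h₆ := deriv_stair_eq_zero i (p := q - 33 / 24) (by linarith) (by linarith)
  have h₇ := deriv_stair_eq_zero i (p := q - 38 / 24) (by linarith) (by linarith)
  have h₈ := deriv_stair_eq_zero (i' + 1) (p := q' - 33 / 24) (by push_cast; linarith)
    (by push_cast; linarith)
  have h₉ : deriv stair (q' - 38 / 24) = deriv stair (q - 14 / 24) := by
    have hp : Function.Periodic (deriv stair) 2 := deriv_stair_add_two
    have := hp.int_mul (i' - i) (q - 14 / 24)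
    rw [← this]; congr 1; push_cast; linarith
  push_cast at h₁ h₃ h₄
  simp [level, roof, twistDeriv, h₁, h₂, h₃, h₄, h₅, h₆, h₇, h₈, h₉]

end Strands

/-! ### The model map -/

/-- The position along the annulus. -/
def position (K ε q : ℝ) : ℝ := K * ε * q + (2 * Real.pi - K * ε) * progress q

/-- The derivative of `position`. -/
def speed (K ε q : ℝ) : ℝ := K * ε + (2 * Real.pi - K * ε) * progressDeriv q

/-- The position across the annulus, before division by the speed. -/
def offset (ε q y R : ℝ) : ℝ :=
  ε / 2 * (1 + y + total q * level q) + roof q + twistDeriv q * R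

/-- The model map in action-angle coordinates of both factors. -/
def flatMap (K ε : ℝ) (w : (ℝ × ℝ) × (ℝ × ℝ)) : (ℝ × ℝ) × (ℝ × ℝ) :=
  ((position K ε w.1.1, offset ε w.1.1 w.1.2 w.2.2 / speed K ε w.1.1),
    (w.2.1 - twist w.1.1, w.2.2))

/-- The model map on the product of the strip and the rectangle. -/
def model (K ε : ℝ) (w d : ℝ × ℝ) : (ℝ × ℝ) × (ℝ × ℝ) :=
  Prod.map polar polar (flatMap K ε ((w.1, height w), d))

section Model

variable {K ε : ℝ}

theorem speed_pos (hK : 0 < K) (hε : 0 < ε) (hKε : K * ε < 2 * Real.pi) (q : ℝ) :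
    0 < speed K ε q :=
  add_pos_of_pos_of_nonneg (mul_pos hK hε)
    (mul_nonneg (by linarith) (progressDeriv_nonneg q))

theorem hasDerivAt_position (q : ℝ) : HasDerivAt (position K ε) (speed K ε q) q := by
  have h₁ := (hasDerivAt_id q).const_mul (K * ε)
  rw [mul_one] at h₁
  exact h₁.add ((hasDerivAt_progress q).const_mul _)

theorem position_strictMono (hK : 0 < K) (hε : 0 < ε) (hKε : K * ε < 2 * Real.pi) :
    StrictMono (position K ε) :=
  strictMono_of_deriv_pos fun q => by
    rw [(hasDerivAt_position q).deriv]; exact speed_pos hK hε hKε q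

theorem progress_add_int (q : ℝ) (k : ℤ) : progress (q + k) = progress q + k := by
  have hp : Function.Periodic (fun q => progress q - q) 1 := fun q => by
    simp only [progress_add_one]; ring
  have := hp.int_mul k q
  simp only [mul_one] at this
  linarith

theorem position_add_int (q : ℝ) (k : ℤ) :
    position K ε (q + k) = position K ε q + 2 * Real.pi * k := by
  simp only [position, progress_add_int]; ring

theorem speed_add_int (q : ℝ) (k : ℤ) : speed K ε (q + k) = speed K ε q := by
  have := progressDeriv_periodic.int_mul k q
  rw [mul_one] at this
  simp only [speed, this]

theorem total_add_int (q : ℝ) (k : ℤ) : total (q + k) = total q := by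
  have := total_periodic.int_mul k q
  rwa [mul_one] at this

/-- The summand 1 in `offset` keeps the lowest edge away from the centre of the disc, where polar
coordinates degenerate. -/
theorem offset_pos (hε : 0 < ε) {q y R : ℝ} (hy : 0 ≤ y) (hR : 0 ≤ R) : 0 < offset ε q y R := by
  have h₁ := mul_nonneg (total_pos q).le (level_nonneg q)
  have h₂ := mul_nonneg (twistDeriv_nonneg q) hR
  have h₃ := roof_nonneg q
  have h₄ : 0 < ε / 2 * (1 + y + total q * level q) := by positivity
  unfold offset; linarith

/-- The thin part is at most `K * ε / 2`, while roof and shear are at most `2π * progressDeriv q`.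
Scaled by `2π / (2π - K * ε)`, the two summands of the speed dominate these separately. -/
theorem offset_lt (hK : ∀ q, 1 + 2 * total q ≤ K) (hε : 0 < ε) (hKε : K * ε < 2 * Real.pi)
    {q v R : ℝ} (hv : v < 1) (hR : R ≤ 1) :
    offset ε q (height (q, v)) R < 2 * Real.pi / (2 * Real.pi - K * ε) * speed K ε q := by
  have h₁ := height_lt_total q hv
  have h₂ := mul_le_mul_of_nonneg_left (level_le_one q) (total_pos q).le
  have h₃ := mul_le_mul_of_nonneg_left hR (twistDeriv_nonneg q)
  have h₄ := roof_add_twistDeriv_le q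
  have h₅ := hK q
  have h₆ : ε / 2 * (1 + height (q, v) + total q * level q) ≤ ε / 2 * K := by
    refine mul_le_mul_of_nonneg_left ?_ (by linarith); linarith
  have hKpos : 0 < K := by linarith [total_pos q]
  have hKε' : 0 < K * ε := mul_pos hKpos hε
  have hd : 0 < 2 * Real.pi - K * ε := by linarith
  have h₇ : 2 * Real.pi / (2 * Real.pi - K * ε) * speed K ε q
      = 2 * Real.pi / (2 * Real.pi - K * ε) * (K * ε) + 2 * Real.pi * progressDeriv q := by
    unfold speed; field_simp
  have h₈ : 1 ≤ 2 * Real.pi / (2 * Real.pi - K * ε) := by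
    rw [le_div_iff₀ hd]; linarith
  have h₉ := mul_le_mul_of_nonneg_right h₈ hKε'.le
  rw [h₇]; unfold offset
  linarith

theorem model_add_two (w d : ℝ × ℝ) : model K ε (w.1 + 2, w.2) d = model K ε w d := by
  have h₁ := position_add_int (K := K) (ε := ε) w.1 2
  have h₂ := speed_add_int (K := K) (ε := ε) w.1 2
  have h₃ := total_add_int w.1 2
  push_cast at h₁ h₂ h₃
  have h₄ := polar_add_two_pi (position K ε w.1)
    (offset ε w.1 (height w) d.2 / speed K ε w.1) 2
  have h₅ := polar_add_two_pi (d.1 - twist w.1) d.2 (-1)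
  push_cast at h₄ h₅
  simp only [model, flatMap, Prod.map, h₁, h₂, offset, h₃, roof_periodic w.1, level_periodic w.1,
    twistDeriv_periodic w.1, twist_add_two, height_add_two w.1 w.2] at h₄ ⊢
  rw [h₄, show d.1 - (twist w.1 + 2 * Real.pi) = d.1 - twist w.1 + 2 * Real.pi * -1 by ring, h₅]

theorem model_add_even (w d : ℝ × ℝ) (k : ℤ) :
    model K ε (w.1 + 2 * k, w.2) d = model K ε w d := by
  have hp : Function.Periodic (fun q => model K ε (q, w.2) d) 2 := fun q =>
    model_add_two (q, w.2) d
  have := hp.int_mul k w.1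
  rw [mul_comm] at this
  exact this

/-- The drop of `level` from 1 to 0 cancels the gain `total` in height, and both angles change by
full turns. -/
theorem model_window {j : ℤ} {w : ℝ × ℝ} (h : |w.1 - (2 * j + 1)| < 1 / 3) (d : ℝ × ℝ) :
    model K ε (w.1 + 1, w.2 + 1) d = model K ε w d := by
  have h₁ := position_add_int (K := K) (ε := ε) w.1 1
  have h₂ := speed_add_int (K := K) (ε := ε) w.1 1
  have h₃ := total_add_int w.1 1
  push_cast at h₁ h₂ h₃
  have h₄ := polar_add_two_pi (position K ε w.1)
    (offset ε w.1 (height w) d.2 / speed K ε w.1) 1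
  have h₅ := polar_add_two_pi (d.1 - twist w.1) d.2 (-1)
  have h₆ := height_add_one w.1 w.2
  have h₇ : offset ε (w.1 + 1) (height (w.1 + 1, w.2 + 1)) d.2 = offset ε w.1 (height w) d.2 := by
    rw [h₆]
    simp only [offset, level_window h, roof_window h, twistDeriv_window h, h₃]; ring
  push_cast at h₄ h₅
  simp only [model, flatMap, Prod.map, h₁, h₂, h₇, twist_window h]
  rw [h₄, show d.1 - (twist w.1 + 2 * Real.pi) = d.1 - twist w.1 + 2 * Real.pi * -1 by ring, h₅]

/-- Two points on different strands of the band have different images. -/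
theorem no_crossing (hε : 0 < ε) {x q q' v v' Θ Θ' R : ℝ} {i i' k : ℤ} (hx : 0 ≤ x) (hx' : x < 1)
    (hq : q = x + 2 * i) (hq' : q' = x + 1 + 2 * i') (hv : v ∈ Set.Ico (0 : ℝ) 1)
    (hv' : v' ∈ Set.Ico (0 : ℝ) 1) (hΘ : Θ ∈ Set.Ioo 0 Real.pi) (hΘ' : Θ' ∈ Set.Ioo 0 Real.pi)
    (hR : R ∈ Set.Ioo (0 : ℝ) 1)
    (h₁ : offset ε q (height (q, v)) R = offset ε q' (height (q', v')) R)
    (h₂ : Θ' - twist q' = Θ - twist q + 2 * Real.pi * k) : False := by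
  have ht : total q' = total q := by
    have := total_add_int q (1 + 2 * i' - 2 * i)
    rw [← this]; congr 1; push_cast; linarith
  have a₁ := height_lt_total q hv.2
  have a₂ := height_nonneg q' hv'.1
  have b₁ := height_lt_total q' hv'.2
  have b₂ := height_nonneg q hv.1
  rcases lt_or_ge x (11 / 24) with c | c
  -- The lower strand stays below `ε / 2 * (1 + total q)`; the upper one is at least that high,
  -- since the shear only raises it.
  · obtain ⟨l₁, l₂, l₃, l₄⟩ := strands_before hx c hq hq'
    have m₁ := mul_nonneg (twistDeriv_nonneg q') hR.1.le
    have m₂ := roof_nonneg q'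
    simp only [offset, l₁, l₂, l₃, l₄, ht] at h₁
    nlinarith
  rcases le_or_gt x (12 / 24) with c' | c'
  -- `Θ' - Θ` would be an odd multiple of `π`, although both angles lie in `(0, π)`.
  · obtain ⟨n, hn⟩ := strands_crossing c c' hq hq'
    rw [hn] at h₂
    have hp := Real.pi_pos
    have e : Θ' - Θ = Real.pi * ((2 * (k + n) + 1 : ℤ) : ℝ) := by push_cast; linarith
    obtain ⟨t₁, t₂⟩ := hΘ
    obtain ⟨t₃, t₄⟩ := hΘ'
    have u₁ : ((2 * (k + n) + 1 : ℤ) : ℝ) < 1 := by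
      by_contra hc
      have := mul_le_mul_of_nonneg_left (not_lt.1 hc) hp.le
      linarith
    have u₂ : (-1 : ℝ) < ((2 * (k + n) + 1 : ℤ) : ℝ) := by
      by_contra hc
      have := mul_le_mul_of_nonneg_left (not_lt.1 hc) hp.le
      linarith
    have u₁' : 2 * (k + n) + 1 < 1 := by exact_mod_cast u₁
    have u₂' : -1 < 2 * (k + n) + 1 := by exact_mod_cast u₂
    omega
  -- The shear of the lower strand is `twistDeriv q' * R` with `R < 1`, so it does not exceed the
  -- roof of the upper one.
  · obtain ⟨l₁, l₂, l₃, l₄, l₅⟩ := strands_after c' hx' hq hq'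
    have m₁ := mul_nonneg (twistDeriv_nonneg q') (sub_nonneg.2 hR.2.le)
    simp only [offset, l₁, l₂, l₃, l₄, l₅, ht] at h₁
    rw [ht] at b₁
    nlinarith

/-- Equal angles in the first factor force `q' - q` to be an integer. If it is even, the points are
on the same strand and height and angle separate them; if it is odd, `no_crossing` applies. -/
theorem model_inj (hK : 0 < K) (hε : 0 < ε) (hKε : K * ε < 2 * Real.pi) {w w' d d' : ℝ × ℝ}
    (hv : w.2 ∈ Set.Ico (0 : ℝ) 1) (hv' : w'.2 ∈ Set.Ico (0 : ℝ) 1)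
    (hΘ : d.1 ∈ Set.Ioo 0 Real.pi) (hΘ' : d'.1 ∈ Set.Ioo 0 Real.pi)
    (hR : d.2 ∈ Set.Ioo (0 : ℝ) 1) (hR' : d'.2 ∈ Set.Ioo (0 : ℝ) 1)
    (h : model K ε w d = model K ε w' d') :
    (∃ k : ℤ, w'.1 = w.1 + 2 * k) ∧ w'.2 = w.2 ∧ d = d' := by
  obtain ⟨q, v⟩ := w
  obtain ⟨q', v'⟩ := w'
  obtain ⟨Θ, R⟩ := d
  obtain ⟨Θ', R'⟩ := d'
  simp only [model, flatMap, Prod.map, Prod.mk.injEq] at h hv hv' hΘ hΘ' hR hR' ⊢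
  have hs := speed_pos hK hε hKε
  obtain ⟨e₁, k, hk⟩ := polar_inj
    (div_pos (offset_pos hε (height_nonneg q hv.1) hR.1.le) (hs q))
    (div_pos (offset_pos hε (height_nonneg q' hv'.1) hR'.1.le) (hs q')) h.1
  obtain ⟨rfl, l, hl⟩ := polar_inj hR.1 hR'.1 h.2
  rw [← position_add_int] at hk
  have hq : q' = q + k := (position_strictMono hK hε hKε).injective hk
  have e₂ : offset ε q (height (q, v)) R = offset ε q' (height (q', v')) R := by
    rw [hq, speed_add_int, ← hq] at e₁
    rwa [div_left_inj' (hs q).ne'] at e₁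
  rcases Int.even_or_odd' k with ⟨m, rfl | rfl⟩
  · have hq2 : q' = q + m * 2 := by rw [hq]; push_cast; ring
    have t₁ : total q' = total q := by rw [hq, total_add_int]
    have t₂ : level q' = level q := by rw [hq2]; exact level_periodic.int_mul m q
    have t₃ : roof q' = roof q := by rw [hq2]; exact roof_periodic.int_mul m q
    have t₄ : twistDeriv q' = twistDeriv q := by rw [hq2]; exact twistDeriv_periodic.int_mul m q
    have t₅ : twist q' = twist q + 2 * Real.pi * m := by
      have hp : Function.Periodic (fun q => twist q - Real.pi * q) 2 := fun q => by
        simp only [twist_add_two]; ring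
      have := hp.int_mul m q
      rw [← hq2] at this
      rw [hq2] at this ⊢
      linarith
    have t₆ : height (q', v') = height (q, v') := by
      have hp : Function.Periodic (fun q => height (q, v')) 2 := fun q => height_add_two q v'
      rw [hq2]; exact hp.int_mul m q
    have hv₂ : v' = v := by
      refine (height_strictMono q).injective ?_
      simp only [offset, t₁, t₂, t₃, t₄, t₆] at e₂
      have hε' : ε / 2 ≠ 0 := by positivity
      have := mul_left_cancel₀ hε' (add_right_cancel (add_right_cancel e₂))
      linarith
    refine ⟨⟨m, by rw [hq2]; ring⟩, hv₂, ?_, rfl⟩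
    have hp := Real.pi_pos
    have e : Θ' - Θ = 2 * Real.pi * ((l + m : ℤ) : ℝ) := by rw [t₅] at hl; push_cast; linarith
    have u₁ : ((l + m : ℤ) : ℝ) < 1 := by
      by_contra hc
      have := mul_le_mul_of_nonneg_left (not_lt.1 hc) (mul_pos two_pos hp).le
      linarith [hΘ.1, hΘ'.2]
    have u₂ : (-1 : ℝ) < ((l + m : ℤ) : ℝ) := by
      by_contra hc
      have := mul_le_mul_of_nonneg_left (not_lt.1 hc) (mul_pos two_pos hp).le
      linarith [hΘ.2, hΘ'.1]
    have u₁' : l + m < 1 := by exact_mod_cast u₁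
    have u₂' : -1 < l + m := by exact_mod_cast u₂
    have : l + m = 0 := by omega
    rw [this] at e
    simp at e
    linarith
  · exfalso
    have hx := Int.fract_nonneg q
    have hx' := Int.fract_lt_one q
    have hf := Int.floor_add_fract q
    push_cast at hq
    rcases Int.even_or_odd' ⌊q⌋ with ⟨i, hi | hi⟩
    · rw [hi] at hf; push_cast at hf
      exact no_crossing hε (i := i) (i' := i + m) (k := l) hx hx' (by linarith)
        (by push_cast; linarith) hv hv' hΘ hΘ' hR e₂ hl
    -- Here `q'` has the even integral part, so the two points exchange roles.
    · rw [hi] at hf; push_cast at hf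
      exact no_crossing hε (i := i + m + 1) (i' := i) (k := -l) hx hx' (by push_cast; linarith)
        (by linarith) hv' hv hΘ' hΘ hR e₂.symm (by push_cast; linarith)

/-- Dividing `offset` by the derivative of `position` gives `dX ∧ dY = dq ∧ d(offset)`. All `dq`
terms of `d(offset)` drop out, and what is left is `ε/2 dq ∧ dy + twistDeriv dq ∧ dR`. Its second
term cancels `-d(twist) ∧ dR` from the second factor. -/
theorem hasFDerivAt_flatMap (w : (ℝ × ℝ) × (ℝ × ℝ)) (hs : speed K ε w.1.1 ≠ 0) :
    ∃ f' : (ℝ × ℝ) × (ℝ × ℝ) →L[ℝ] (ℝ × ℝ) × (ℝ × ℝ), HasFDerivAt (flatMap K ε) f' w ∧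
      ∀ u v, area (f' u).1 (f' v).1 + area (f' u).2 (f' v).2
        = ε / 2 * area u.1 v.1 + area u.2 v.2 := by
  have p₁ : HasFDerivAt (fun w : (ℝ × ℝ) × (ℝ × ℝ) => w.1) _ w :=
    hasFDerivAt_fst (𝕜 := ℝ)
  have p₂ : HasFDerivAt (fun w : (ℝ × ℝ) × (ℝ × ℝ) => w.2) _ w :=
    hasFDerivAt_snd (𝕜 := ℝ)
  have hq : HasFDerivAt (fun w : (ℝ × ℝ) × (ℝ × ℝ) => w.1.1) _ w := p₁.fst
  have hy : HasFDerivAt (fun w : (ℝ × ℝ) × (ℝ × ℝ) => w.1.2) _ w := p₁.snd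
  have hΘ : HasFDerivAt (fun w : (ℝ × ℝ) × (ℝ × ℝ) => w.2.1) _ w := p₂.fst
  have hR : HasFDerivAt (fun w : (ℝ × ℝ) × (ℝ × ℝ) => w.2.2) _ w := p₂.snd
  have d₁ := (contDiff_total.differentiable (by simp) w.1.1).hasDerivAt.comp_hasFDerivAt w hq
  have d₂ := (contDiff_level.differentiable (by simp) w.1.1).hasDerivAt.comp_hasFDerivAt w hq
  have d₃ := (contDiff_roof.differentiable (by simp) w.1.1).hasDerivAt.comp_hasFDerivAt w hq
  have d₄ := (contDiff_twistDeriv.differentiable (by simp) w.1.1).hasDerivAt.comp_hasFDerivAt w hq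
  have d₅ : HasDerivAt (fun q => (speed K ε q)⁻¹)
      (deriv (fun q => (speed K ε q)⁻¹) w.1.1) w.1.1 := by
    refine DifferentiableAt.hasDerivAt (DifferentiableAt.inv ?_ hs)
    have := contDiff_progressDeriv.differentiable (by simp)
    unfold speed; fun_prop
  have d₆ := d₅.comp_hasFDerivAt w hq
  have hX := (hasDerivAt_position (K := K) (ε := ε) w.1.1).comp_hasFDerivAt w hq
  have hT := (hasDerivAt_twist w.1.1).comp_hasFDerivAt w hq
  have hN := ((((hy.const_add 1).add (d₁.mul d₂)).const_mul (ε / 2)).add d₃).add (d₄.mul hR)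
  have hY := hN.mul d₆
  refine ⟨_, (hX.prodMk hY).prodMk ((hΘ.sub hT).prodMk hR), fun u v => ?_⟩
  simp [area]
  field_simp
  ring

end Model

/-! ### The lifted embedding -/

/-- The embedding, as a periodic map on the product of the punctured plane and the disc. -/
def planeMap (K ε : ℝ) (z b : ℝ × ℝ) : (ℝ × ℝ) × (ℝ × ℝ) :=
  model K ε (stripCoord z) (discToRect b)

section PlaneMap

variable {K ε : ℝ} {z b : ℝ × ℝ}

theorem planeMap_add_int (z b : ℝ × ℝ) (m n : ℤ) :
    planeMap K ε (z + ((m : ℝ), (n : ℝ))) b = planeMap K ε z b := by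
  have := model_add_even (K := K) (ε := ε) (stripCoord z) (discToRect b) m
  rw [planeMap, planeMap, stripCoord_add_int, ← this]
  congr 1
  ext <;> simp

/-- Near each point, the embedding is given by the model map on one translate of the strip. -/
theorem planeMap_eventuallyEq (K : ℝ) (hz : 0 < nsq (cell z)) :
    ∃ n : ℤ, stripCoord z = slant (rad z) - ((n : ℝ), (n : ℝ)) ∧
      ∀ᶠ y in nhds z, ∀ ε b, planeMap K ε y b
        = model K ε (slant (rad y) - ((n : ℝ), (n : ℝ))) (discToRect b) := by
  have hc : ContinuousAt (fun y => slant (rad y)) z := by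
    have h₁ : Continuous slant := by unfold slant; fun_prop
    exact h₁.continuousAt.comp (contDiffAt_rad hz).continuousAt
  have hc₁ : ContinuousAt (fun y => (slant (rad y)).1) z := continuousAt_fst.comp hc
  have hc₂ : ContinuousAt (fun y => (slant (rad y)).2) z := continuousAt_snd.comp hc
  set n := ⌊(slant (rad z)).2⌋ with hn
  have hn₁ : (n : ℝ) ≤ (slant (rad z)).2 := Int.floor_le _
  have hn₂ : (slant (rad z)).2 < n + 1 := Int.lt_floor_add_one _
  refine ⟨n, rfl, ?_⟩
  rcases hn₁.lt_or_eq with h | h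
  · filter_upwards [hc₂.eventually (Ioo_mem_nhds h hn₂)] with y hy ε b
    have : ⌊(slant (rad y)).2⌋ = n := by
      rw [Int.floor_eq_iff]; exact ⟨hy.1.le, hy.2⟩
    rw [planeMap, stripCoord, toStrip, this]
    rfl
  -- On the lower edge of strip `n` nearby points lie in strip `n` or `n - 1`; at a window the
  -- formula of strip `n` is correct for both.
  · obtain ⟨j, hj⟩ := stripCoord_window hz (by simp only [stripCoord, toStrip]; linarith)
    simp only [stripCoord, toStrip, ← hn] at hj
    have hc₃ : ContinuousAt (fun y => |(slant (rad y)).1 - n - (2 * j + 1)|) z :=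
      ((hc₁.sub continuousAt_const).sub continuousAt_const).abs
    filter_upwards [hc₂.eventually (Ioo_mem_nhds (show (n : ℝ) - 1 < _ by linarith) hn₂),
      hc₃.eventually (gt_mem_nhds hj)] with y hy hy' ε b
    rcases le_or_gt (n : ℝ) (slant (rad y)).2 with h' | h'
    · have : ⌊(slant (rad y)).2⌋ = n := by
        rw [Int.floor_eq_iff]; exact ⟨h', hy.2⟩
      rw [planeMap, stripCoord, toStrip, this]
      rfl
    · have : ⌊(slant (rad y)).2⌋ = n - 1 := by
        rw [Int.floor_eq_iff]; push_cast; exact ⟨hy.1.le, by linarith⟩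
      have hw := model_window (K := K) (ε := ε) (w := slant (rad y) - ((n : ℝ), (n : ℝ))) hy'
        (discToRect b)
      rw [planeMap, stripCoord, toStrip, this, ← hw]
      congr 1
      ext <;> simp <;> ring

theorem planeMap_inj (hK : 0 < K) (hε : 0 < ε) (hKε : K * ε < 2 * Real.pi) {z' b' : ℝ × ℝ}
    (hz : 0 < nsq (cell z)) (hz' : 0 < nsq (cell z')) (hb : nsq b < 1) (hb' : nsq b' < 1)
    (h : planeMap K ε z b = planeMap K ε z' b') :
    (∃ m n : ℤ, z' = z + ((m : ℝ), (n : ℝ))) ∧ b = b' := by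
  have hd := discToRect_mem hb
  have hd' := discToRect_mem hb'
  obtain ⟨⟨k, hk⟩, hv, e⟩ := model_inj hK hε hKε (toStrip_snd_mem _) (toStrip_snd_mem _) hd.1 hd'.1
    hd.2 hd'.2 h
  exact ⟨exists_int_of_stripCoord hz hz' hk hv, discToRect_inj hb hb' e⟩

theorem planeMap_mem (hK : ∀ q, 1 + 2 * total q ≤ K) (hε : 0 < ε) (hKε : K * ε ≤ 1)
    (hb : nsq b < 1) :
    nsq (planeMap K ε z b).1 < (Real.sqrt 2 + K * ε) ^ 2 ∧ nsq (planeMap K ε z b).2 < 2 := by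
  have hd := discToRect_mem hb
  have hv : (stripCoord z).2 ∈ Set.Ico (0 : ℝ) 1 := toStrip_snd_mem _
  have hpi := Real.pi_gt_three
  have hKpos : 0 < K := by linarith [total_pos 0, hK 0]
  have hKε' : 0 < K * ε := mul_pos hKpos hε
  have hs := speed_pos hKpos hε (by linarith) (stripCoord z).1
  have h₁ := offset_pos hε (q := (stripCoord z).1) (height_nonneg (stripCoord z).1 hv.1) hd.2.1.le
  have h₂ := offset_lt hK hε (by linarith) (q := (stripCoord z).1) hv.2 hd.2.2.le
  constructor
  · have e : nsq (planeMap K ε z b).1 = 2 * (offset ε (stripCoord z).1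
        (height (stripCoord z)) (discToRect b).2 / speed K ε (stripCoord z).1) :=
      nsq_polar _ (div_pos h₁ hs).le
    have h₃ : offset ε (stripCoord z).1 (height (stripCoord z)) (discToRect b).2
        / speed K ε (stripCoord z).1 < 2 * Real.pi / (2 * Real.pi - K * ε) := by
      rw [div_lt_iff₀ hs]; exact h₂
    -- With `t = K * ε ≤ 1` one has `(1 + t)(2π - t) ≥ 2π`. The radius then comes from `2(1 + t) <
    -- (√2 + t)²`.
    have h₄ : 2 * Real.pi / (2 * Real.pi - K * ε) ≤ 1 + K * ε := by
      rw [div_le_iff₀ (by linarith)]; nlinarith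
    have h₅ : 1 ≤ Real.sqrt 2 := Real.one_le_sqrt.2 (by norm_num)
    have h₆ := Real.sq_sqrt (show (0 : ℝ) ≤ 2 by norm_num)
    rw [e]
    nlinarith
  · have e : nsq (planeMap K ε z b).2 = 2 * (discToRect b).2 := nsq_polar _ hd.2.1.le
    rw [e]; linarith [hd.2.2]

/-- The embedding is smooth, jointly in the parameter and the point. -/
theorem contDiffAt_planeMap (hK : 0 < K) (hε : 0 < ε) (hKε : K * ε < 2 * Real.pi)
    (hz : 0 < nsq (cell z)) (hb : nsq b < 1) :
    ContDiffAt ℝ ∞ (fun p : ℝ × ((ℝ × ℝ) × (ℝ × ℝ)) => planeMap K p.1 p.2.1 p.2.2)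
      (ε, (z, b)) := by
  obtain ⟨n, hn, hev⟩ := planeMap_eventuallyEq K hz
  have hd := discToRect_mem hb
  have hv : (stripCoord z).2 ∈ Set.Ico (0 : ℝ) 1 := toStrip_snd_mem _
  have hs := speed_pos hK hε hKε (stripCoord z).1
  have hpos := offset_pos hε (q := (stripCoord z).1) (height_nonneg (stripCoord z).1 hv.1) hd.2.1.le
  rw [hn] at hs hpos
  have cε : ContDiffAt ℝ ∞ (fun p : ℝ × ((ℝ × ℝ) × (ℝ × ℝ)) => p.1) (ε, (z, b)) := contDiffAt_fst
  have cz : ContDiffAt ℝ ∞ (fun p : ℝ × ((ℝ × ℝ) × (ℝ × ℝ)) => rad p.2.1) (ε, (z, b)) :=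
    ContDiffAt.comp (g := rad) (f := fun p : ℝ × ((ℝ × ℝ) × (ℝ × ℝ)) => p.2.1) _
      (contDiffAt_rad hz) (by fun_prop)
  have cd : ContDiffAt ℝ ∞ (fun p : ℝ × ((ℝ × ℝ) × (ℝ × ℝ)) => discToRect p.2.2) (ε, (z, b)) :=
    ContDiffAt.comp (g := discToRect) (f := fun p : ℝ × ((ℝ × ℝ) × (ℝ × ℝ)) => p.2.2) _
      (contDiffAt_discToRect hb) (by fun_prop)
  have cw : ContDiffAt ℝ ∞ (fun p : ℝ × ((ℝ × ℝ) × (ℝ × ℝ)) =>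
      slant (rad p.2.1) - ((n : ℝ), (n : ℝ))) (ε, (z, b)) := by
    have : ContDiff ℝ ∞ slant := by unfold slant; fun_prop
    exact (this.contDiffAt.comp _ cz).sub contDiffAt_const
  have cq := contDiffAt_fst.comp _ cw
  have c₁ := contDiff_total.contDiffAt.comp _ cq
  have c₂ := contDiff_level.contDiffAt.comp _ cq
  have c₃ := contDiff_roof.contDiffAt.comp _ cq
  have c₄ := contDiff_twistDeriv.contDiffAt.comp _ cq
  have c₅ := contDiff_progress.contDiffAt.comp _ cq
  have c₆ := contDiff_progressDeriv.contDiffAt.comp _ cq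
  have c₇ := contDiff_twist.contDiffAt.comp _ cq
  have c₈ := contDiff_height.contDiffAt.comp _ cw
  have cΘ := contDiffAt_fst.comp _ cd
  have cR := contDiffAt_snd.comp _ cd
  have cKε := (contDiffAt_const (c := K)).mul cε
  have cK' := (contDiffAt_const (c := 2 * Real.pi)).sub cKε
  have cX := (cKε.mul cq).add (cK'.mul c₅)
  have cS := cKε.add (cK'.mul c₆)
  have cN := (((cε.div_const 2).mul (((contDiffAt_const (c := (1 : ℝ))).add c₈).add
    (c₁.mul c₂))).add c₃).add (c₄.mul cR)
  have cY := cN.div cS hs.ne'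
  have h₁ := ContDiffAt.comp (ε, (z, b)) (contDiffAt_polar (div_pos hpos hs)) (cX.prodMk cY)
  have h₂ := ContDiffAt.comp (ε, (z, b)) (contDiffAt_polar hd.2.1) ((cΘ.sub c₇).prodMk cR)
  refine (h₁.prodMk h₂).congr_of_eventuallyEq ?_
  have ht : Filter.Tendsto (fun p : ℝ × ((ℝ × ℝ) × (ℝ × ℝ)) => p.2.1) (nhds (ε, (z, b)))
      (nhds z) := (by fun_prop : Continuous fun p : ℝ × ((ℝ × ℝ) × (ℝ × ℝ)) => p.2.1).tendsto _
  filter_upwards [ht.eventually hev] with p hp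
  exact hp _ _

theorem HasJacobianAt.prodMap {f g : ℝ × ℝ → ℝ × ℝ} {k l : ℝ} {w : (ℝ × ℝ) × (ℝ × ℝ)}
    (hf : HasJacobianAt f k w.1) (hg : HasJacobianAt g l w.2) :
    ∃ f' : (ℝ × ℝ) × (ℝ × ℝ) →L[ℝ] (ℝ × ℝ) × (ℝ × ℝ), HasFDerivAt (Prod.map f g) f' w ∧
      ∀ u v, area (f' u).1 (f' v).1 = k * area u.1 v.1 ∧
        area (f' u).2 (f' v).2 = l * area u.2 v.2 := by
  obtain ⟨f', hf, hf'⟩ := hf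
  obtain ⟨g', hg, hg'⟩ := hg
  exact ⟨_, hf.prodMap w hg, fun u v => ⟨hf' _ _, hg' _ _⟩⟩

/-- The factor `ε` is the product of 2 from the strip coordinates and `ε / 2` from `flatMap`. -/
theorem hasFDerivAt_planeMap (hK : 0 < K) (hε : 0 < ε) (hKε : K * ε < 2 * Real.pi)
    (hz : 0 < nsq (cell z)) (hb : nsq b < 1) :
    ∃ f' : (ℝ × ℝ) × (ℝ × ℝ) →L[ℝ] (ℝ × ℝ) × (ℝ × ℝ),
      HasFDerivAt (fun p : (ℝ × ℝ) × (ℝ × ℝ) => planeMap K ε p.1 p.2) f' (z, b) ∧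
      ∀ u v, area (f' u).1 (f' v).1 + area (f' u).2 (f' v).2
        = ε * area u.1 v.1 + area u.2 v.2 := by
  obtain ⟨n, hn, hev⟩ := planeMap_eventuallyEq K hz
  have hd := discToRect_mem hb
  have hv : (stripCoord z).2 ∈ Set.Ico (0 : ℝ) 1 := toStrip_snd_mem _
  have hs := speed_pos hK hε hKε (stripCoord z).1
  have hpos := offset_pos hε (q := (stripCoord z).1) (height_nonneg (stripCoord z).1 hv.1) hd.2.1.le
  rw [hn] at hs hpos
  obtain ⟨f₁, h₁, h₁'⟩ := HasJacobianAt.prodMap (w := (z, b)) (hasJacobianAt_stripMap hz n)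
    (hasJacobianAt_discToRect hb)
  set g := Prod.map (fun z => let w := slant (rad z) - ((n : ℝ), (n : ℝ)); (w.1, height w))
    discToRect with hg
  obtain ⟨f₂, h₂, h₂'⟩ := hasFDerivAt_flatMap (K := K) (ε := ε) (g (z, b)) hs.ne'
  obtain ⟨f₃, h₃, h₃'⟩ := HasJacobianAt.prodMap (w := flatMap K ε (g (z, b)))
    (hasJacobianAt_polar (div_pos hpos hs)) (hasJacobianAt_polar hd.2.1)
  have h₄ := HasFDerivAt.comp (f := flatMap K ε ∘ g) (z, b) h₃ (h₂.comp (z, b) h₁)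
  refine ⟨_, h₄.congr_of_eventuallyEq ?_, fun u v => ?_⟩
  · have ht : Filter.Tendsto (fun p : (ℝ × ℝ) × (ℝ × ℝ) => p.1) (nhds (z, b)) (nhds z) :=
      continuous_fst.tendsto _
    filter_upwards [ht.eventually hev] with p hp
    exact hp _ _
  · simp only [ContinuousLinearMap.comp_apply, h₃', one_mul, h₂', h₁']
    ring

end PlaneMap

/-! ### Charts of the torus and of open subsets -/

section Opens

variable {E H : Type*} [NormedAddCommGroup E] [NormedSpace ℝ E] [TopologicalSpace H]
  {I : ModelWithCorners ℝ E H} {M : Type*} [TopologicalSpace M] [ChartedSpace H M]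

/-- In the charts, the inclusion of an open subset is the identity. -/
theorem hasMFDerivAt_opens_val (U : TopologicalSpace.Opens M) (x : U) :
    HasMFDerivAt I I (Subtype.val : U → M) x (ContinuousLinearMap.id ℝ E) := by
  refine ⟨continuous_subtype_val.continuousAt, ?_⟩
  have key : ∀ y ∈ (extChartAt I x).target,
      writtenInExtChartAt I I x (Subtype.val : U → M) y = y := fun y hy => by
    simp only [mfld_simps, TopologicalSpace.Opens.chartAt_eq] at hy ⊢
    rw [← Function.comp_apply (f := Subtype.val),
      ← OpenPartialHomeomorph.subtypeRestr_symm_eqOn (chartAt H x.1) ⟨x⟩ hy.2,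
      (chartAt H x.1).right_inv (OpenPartialHomeomorph.subtypeRestr_target_subset _ _ hy.2),
      I.right_inv hy.1]
  refine HasFDerivWithinAt.congr_of_eventuallyEq (hasFDerivWithinAt_id _ _) ?_
    (key _ (mem_extChartAt_target x))
  filter_upwards [extChartAt_target_mem_nhdsWithin (I := I) x] with y hy
  exact key y hy

/-- In the charts, the chart at a point is the identity there. -/
theorem hasMFDerivAt_extChartAt_self (x : M) :
    HasMFDerivAt I 𝓘(ℝ, E) (extChartAt I x) x (ContinuousLinearMap.id ℝ E) := by
  refine ⟨continuousAt_extChartAt x, ?_⟩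
  have key : ∀ y ∈ (extChartAt I x).target,
      writtenInExtChartAt I 𝓘(ℝ, E) x (extChartAt I x) y = y := fun y hy =>
    (extChartAt I x).right_inv hy
  refine HasFDerivWithinAt.congr_of_eventuallyEq (hasFDerivWithinAt_id _ _) ?_
    (key _ (mem_extChartAt_target x))
  filter_upwards [extChartAt_target_mem_nhdsWithin (I := I) x] with y hy
  exact key y hy

end Opens

/-- A local section of the covering of the torus. -/
def torusSection {a : ℝ} (τ σ : Torus a) : ℝ × ℝ := (chartAt ℝ τ.1 σ.1, chartAt ℝ τ.2 σ.2)

theorem torusProj_torusSection {a : ℝ} (τ : Torus a) :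
    ∀ᶠ σ in nhds τ, torusProj a (torusSection τ σ) = σ := by
  have h : ∀ x : AddCircle a, ∀ᶠ y in nhds x, ((chartAt ℝ x y : ℝ) : AddCircle a) = y := fun x => by
    filter_upwards [chart_source_mem_nhds ℝ x] with y hy
    rw [← AddCircle.coe_atlas_symm (chart_mem_atlas ℝ x), (chartAt ℝ x).left_inv hy]
  filter_upwards [(continuous_fst.tendsto τ).eventually (h τ.1),
    (continuous_snd.tendsto τ).eventually (h τ.2)] with σ h₁ h₂
  exact Prod.ext h₁ h₂

theorem contMDiffAt_torusSection {a : ℝ} (τ : Torus a) :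
    ContMDiffAt (𝓘(ℝ).prod 𝓘(ℝ)) 𝓘(ℝ, ℝ × ℝ) ∞ (torusSection τ) τ := by
  have h : ∀ x : AddCircle a, ContMDiffAt 𝓘(ℝ) 𝓘(ℝ) ∞ (chartAt ℝ x) x := fun x =>
    contMDiffAt_extChartAt (I := 𝓘(ℝ)) (x := x)
  exact ContMDiffAt.prodMk_space ((h τ.1).comp τ contMDiffAt_fst) ((h τ.2).comp τ contMDiffAt_snd)

theorem hasMFDerivAt_torusSection {a : ℝ} (τ : Torus a) :
    HasMFDerivAt (𝓘(ℝ).prod 𝓘(ℝ)) 𝓘(ℝ, ℝ × ℝ) (torusSection τ) τ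
      (ContinuousLinearMap.id ℝ (ℝ × ℝ)) := by
  exact hasMFDerivAt_extChartAt_self (I := 𝓘(ℝ).prod 𝓘(ℝ)) τ

theorem torusProj_surjective (a : ℝ) : Function.Surjective (torusProj a) := fun σ => by
  obtain ⟨x, hx⟩ := QuotientAddGroup.mk_surjective σ.1
  obtain ⟨y, hy⟩ := QuotientAddGroup.mk_surjective σ.2
  exact ⟨(x, y), Prod.ext hx hy⟩

theorem continuous_torusProj (a : ℝ) : Continuous (torusProj a) :=
  ((AddCircle.continuous_mk' a).comp continuous_fst).prodMk
    ((AddCircle.continuous_mk' a).comp continuous_snd)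

theorem exists_int_of_torusProj_eq {a : ℝ} (ha : a ≠ 0) {z z' : ℝ × ℝ}
    (h : torusProj a z = torusProj a z') :
    ∃ m n : ℤ, a⁻¹ • z' = a⁻¹ • z + ((m : ℝ), (n : ℝ)) := by
  have key : ∀ x y : ℝ, (x : AddCircle a) = y → ∃ m : ℤ, a⁻¹ * y = a⁻¹ * x + m := by
    intro x y hxy
    obtain ⟨m, hm⟩ := AddSubgroup.mem_zmultiples_iff.1 (QuotientAddGroup.eq.1 hxy)
    refine ⟨m, ?_⟩
    have : y = x + m * a := by rw [zsmul_eq_mul] at hm; linarith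
    rw [this]; field_simp
  simp only [torusProj, Prod.mk.injEq] at h
  obtain ⟨m, hm⟩ := key _ _ h.1
  obtain ⟨n, hn⟩ := key _ _ h.2
  exact ⟨m, n, Prod.ext hm hn⟩

theorem torusProj_eq_of_int {a : ℝ} (ha : a ≠ 0) {z z' : ℝ × ℝ} {m n : ℤ}
    (h : a⁻¹ • z' = a⁻¹ • z + ((m : ℝ), (n : ℝ))) : torusProj a z = torusProj a z' := by
  have key : ∀ (x y : ℝ) (m : ℤ), a⁻¹ * y = a⁻¹ * x + m → (x : AddCircle a) = y := by
    intro x y m hxy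
    refine QuotientAddGroup.eq.2 (AddSubgroup.mem_zmultiples_iff.2 ⟨m, ?_⟩)
    rw [zsmul_eq_mul]
    field_simp at hxy
    linarith
  exact Prod.ext (key _ _ m (congrArg Prod.fst h)) (key _ _ n (congrArg Prod.snd h))

theorem nsq_cell_pos_of_mem {a : ℝ} (ha : a ≠ 0) {z : ℝ × ℝ}
    (h : torusProj a z ∈ puncturedTorus a) : 0 < nsq (cell (a⁻¹ • z)) := by
  refine lt_of_le_of_ne (nsq_nonneg _) fun h₀ => h ?_
  have hsq : (cell (a⁻¹ • z)).1 ^ 2 + (cell (a⁻¹ • z)).2 ^ 2 = 0 := h₀.symm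
  have h₁ : (cell (a⁻¹ • z)).1 = 0 := by nlinarith [sq_nonneg (cell (a⁻¹ • z)).2]
  have h₂ : (cell (a⁻¹ • z)).2 = 0 := by nlinarith [sq_nonneg (cell (a⁻¹ • z)).1]
  simp only [cell, sub_eq_zero] at h₁ h₂
  have := torusProj_eq_of_int (a := a) ha (z := 0) (z' := z) (m := round (a⁻¹ • z).1)
    (n := round (a⁻¹ • z).2) (by rw [smul_zero, zero_add]; exact Prod.ext h₁ h₂)
  rw [← this]
  simp [torusProj]

theorem mem_disc_iff {r : ℝ} (hr : 0 < r) {b : ℝ × ℝ} : b ∈ disc r ↔ nsq b < r ^ 2 :=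
  Real.sqrt_lt' hr

/-! ### The embedding of the punctured torus -/

/-- A representative in the plane of a point of the torus. -/
def torusRep {a : ℝ} (σ : Torus a) : ℝ × ℝ := Function.surjInv (torusProj_surjective a) σ

theorem torusProj_torusRep {a : ℝ} (σ : Torus a) : torusProj a (torusRep σ) = σ :=
  Function.surjInv_eq _ σ

/-- The map that `planeMap` induces on the torus of side `a`. -/
def puncturedTorusMap (K ε a : ℝ) (p : puncturedTorus a × disc 1) : (ℝ × ℝ) × (ℝ × ℝ) :=
  planeMap K ε (a⁻¹ • torusRep p.1.1) p.2.1

theorem hasMFDerivAt_prodMk_space {E H E' E'' M : Type*} [NormedAddCommGroup E] [NormedSpace ℝ E]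
    [TopologicalSpace H] [NormedAddCommGroup E'] [NormedSpace ℝ E'] [NormedAddCommGroup E'']
    [NormedSpace ℝ E''] [TopologicalSpace M] [ChartedSpace H M] {I : ModelWithCorners ℝ E H}
    {f : M → E'} {g : M → E''} {x : M} {f' : E →L[ℝ] E'} {g' : E →L[ℝ] E''}
    (hf : HasMFDerivAt I 𝓘(ℝ, E') f x f') (hg : HasMFDerivAt I 𝓘(ℝ, E'') g x g') :
    HasMFDerivAt I 𝓘(ℝ, E' × E'') (fun y => (f y, g y)) x (f'.prod g') :=
  ⟨hf.1.prodMk hg.1, HasFDerivWithinAt.prodMk hf.2 hg.2⟩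

section PuncturedTorusMap

variable {K ε a : ℝ}

theorem puncturedTorusMap_eq (ha : a ≠ 0) (p : puncturedTorus a × disc 1) {z : ℝ × ℝ}
    (hz : torusProj a z = p.1.1) : puncturedTorusMap K ε a p = planeMap K ε (a⁻¹ • z) p.2.1 := by
  obtain ⟨m, n, h⟩ := exists_int_of_torusProj_eq ha (hz.trans (torusProj_torusRep p.1.1).symm)
  rw [puncturedTorusMap, h, planeMap_add_int]

theorem nsq_lt_one (b : disc 1) : nsq b.1 < 1 := by
  have := (mem_disc_iff one_pos).1 b.2
  simpa using this

theorem puncturedTorusMap_injective (ha : a ≠ 0) (hK : 0 < K) (hε : 0 < ε)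
    (hKε : K * ε < 2 * Real.pi) :
    Function.Injective (puncturedTorusMap K ε a) := fun p p' h => by
  have hp : ∀ p : puncturedTorus a × disc 1, 0 < nsq (cell (a⁻¹ • torusRep p.1.1)) := fun p =>
    nsq_cell_pos_of_mem ha (by rw [torusProj_torusRep]; exact p.1.2)
  obtain ⟨⟨m, n, e⟩, hb⟩ := planeMap_inj hK hε hKε (hp p) (hp p') (nsq_lt_one _) (nsq_lt_one _) h
  have := torusProj_eq_of_int ha e
  rw [torusProj_torusRep, torusProj_torusRep] at this
  exact Prod.ext (Subtype.ext this) (Subtype.ext hb)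

/-- A local lift of points of the product to the covering. -/
def localLift (p₀ p : puncturedTorus a × disc 1) : (ℝ × ℝ) × (ℝ × ℝ) :=
  (a⁻¹ • torusSection p₀.1.1 p.1.1, p.2.1)

theorem puncturedTorusMap_eventuallyEq (K : ℝ) (ha : a ≠ 0) (p₀ : puncturedTorus a × disc 1) :
    ∀ᶠ p in nhds p₀, ∀ ε, puncturedTorusMap K ε a p
      = planeMap K ε (localLift p₀ p).1 (localLift p₀ p).2 := by
  have ht : Filter.Tendsto (fun p : puncturedTorus a × disc 1 => p.1.1) (nhds p₀) (nhds p₀.1.1) :=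
    (continuous_subtype_val.comp continuous_fst).tendsto p₀
  filter_upwards [ht.eventually (torusProj_torusSection p₀.1.1)] with p hp ε
  exact puncturedTorusMap_eq ha p hp

theorem nsq_cell_localLift_pos (ha : a ≠ 0) (p₀ : puncturedTorus a × disc 1) :
    0 < nsq (cell (localLift p₀ p₀).1) :=
  nsq_cell_pos_of_mem ha (by rw [(torusProj_torusSection p₀.1.1).self_of_nhds]; exact p₀.1.2)

theorem contMDiffAt_localLift_fst (p₀ : puncturedTorus a × disc 1) :
    ContMDiffAt ((𝓘(ℝ).prod 𝓘(ℝ)).prod 𝓘(ℝ, ℝ × ℝ)) 𝓘(ℝ, ℝ × ℝ) ∞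
      (fun p => (localLift p₀ p).1) p₀ := by
  have h₁ : ContMDiffAt ((𝓘(ℝ).prod 𝓘(ℝ)).prod 𝓘(ℝ, ℝ × ℝ)) (𝓘(ℝ).prod 𝓘(ℝ)) ∞
      (fun p : puncturedTorus a × disc 1 => (p.1.1 : Torus a)) p₀ :=
    contMDiff_subtype_val.contMDiffAt.comp p₀ contMDiffAt_fst
  have h₂ := ContMDiffAt.comp p₀ (contMDiffAt_torusSection p₀.1.1) h₁
  exact (contDiff_const_smul a⁻¹).contMDiff.contMDiffAt.comp p₀ h₂

theorem contMDiffAt_localLift_snd (p₀ : puncturedTorus a × disc 1) :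
    ContMDiffAt ((𝓘(ℝ).prod 𝓘(ℝ)).prod 𝓘(ℝ, ℝ × ℝ)) 𝓘(ℝ, ℝ × ℝ) ∞
      (fun p => (localLift p₀ p).2) p₀ :=
  contMDiff_subtype_val.contMDiffAt.comp p₀ contMDiffAt_snd

/-- The map is smooth, jointly in the parameter and the point. -/
theorem contMDiffAt_puncturedTorusMap (ha : a ≠ 0) (hK : 0 < K) (hε : 0 < ε)
    (hKε : K * ε < 2 * Real.pi)
    (p₀ : puncturedTorus a × disc 1) :
    ContMDiffAt (𝓘(ℝ).prod ((𝓘(ℝ).prod 𝓘(ℝ)).prod 𝓘(ℝ, ℝ × ℝ)))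
      (𝓘(ℝ, ℝ × ℝ).prod 𝓘(ℝ, ℝ × ℝ)) ∞
      (fun x : ℝ × (puncturedTorus a × disc 1) => puncturedTorusMap K x.1 a x.2) (ε, p₀) := by
  have h := (contDiffAt_planeMap hK hε hKε (nsq_cell_localLift_pos ha p₀)
    (b := (localLift p₀ p₀).2) (nsq_lt_one p₀.2)).contMDiffAt
  have h₁ := ContMDiffAt.comp (ε, p₀) (contMDiffAt_localLift_fst p₀)
    (contMDiffAt_snd (I := 𝓘(ℝ)) (M := ℝ) (p := (ε, p₀)))
  have h₂ := ContMDiffAt.comp (ε, p₀) (contMDiffAt_localLift_snd p₀)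
    (contMDiffAt_snd (I := 𝓘(ℝ)) (M := ℝ) (p := (ε, p₀)))
  have h₃ := (contMDiffAt_fst (I := 𝓘(ℝ)) (M := ℝ)
    (J := (𝓘(ℝ).prod 𝓘(ℝ)).prod 𝓘(ℝ, ℝ × ℝ)) (p := (ε, p₀)) (n := ∞)).prodMk_space
      (h₁.prodMk_space h₂)
  have h₄ := ContMDiffAt.comp (ε, p₀) h h₃
  have h₅ := (contDiff_fst (𝕜 := ℝ) (E := ℝ × ℝ) (F := ℝ × ℝ) (n := ∞)).contMDiff.contMDiffAt.comp
    (ε, p₀) h₄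
  have h₆ := (contDiff_snd (𝕜 := ℝ) (E := ℝ × ℝ) (F := ℝ × ℝ) (n := ∞)).contMDiff.contMDiffAt.comp
    (ε, p₀) h₄
  refine (h₅.prodMk h₆).congr_of_eventuallyEq ?_
  have ht : Filter.Tendsto (fun x : ℝ × (puncturedTorus a × disc 1) => x.2) (nhds (ε, p₀))
    (nhds p₀) := continuous_snd.tendsto _
  filter_upwards [ht.eventually (puncturedTorusMap_eventuallyEq K ha p₀)] with x hx
  exact hx _

theorem contMDiff_puncturedTorusMap (ha : a ≠ 0) (hK : 0 < K) (hε : 0 < ε)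
    (hKε : K * ε < 2 * Real.pi) :
    ContMDiff ((𝓘(ℝ).prod 𝓘(ℝ)).prod 𝓘(ℝ, ℝ × ℝ)) (𝓘(ℝ, ℝ × ℝ).prod 𝓘(ℝ, ℝ × ℝ)) ∞
      (puncturedTorusMap K ε a) := fun p₀ =>
  ContMDiffAt.comp (g := fun x : ℝ × (puncturedTorus a × disc 1) => puncturedTorusMap K x.1 a x.2)
    (f := fun p => (ε, p)) p₀ (contMDiffAt_puncturedTorusMap ha hK hε hKε p₀)
    (contMDiffAt_const.prodMk contMDiffAt_id)

theorem area_zero_left (u : ℝ × ℝ) (h : ∀ v, area u v = 0) : u = 0 := by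
  have h₁ := h (0, 1)
  have h₂ := h (1, 0)
  simp [area] at h₁ h₂
  exact Prod.ext h₁ h₂

/-- The derivative of the map in the charts. -/
theorem hasMFDerivAt_puncturedTorusMap (ha : a ≠ 0) (hK : 0 < K) (hε : 0 < ε)
    (hKε : K * ε < 2 * Real.pi)
    (p₀ : puncturedTorus a × disc 1) :
    ∃ f' : (ℝ × ℝ) × (ℝ × ℝ) →L[ℝ] (ℝ × ℝ) × (ℝ × ℝ),
      HasMFDerivAt ((𝓘(ℝ).prod 𝓘(ℝ)).prod 𝓘(ℝ, ℝ × ℝ)) (𝓘(ℝ, ℝ × ℝ).prod 𝓘(ℝ, ℝ × ℝ))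
        (puncturedTorusMap K ε a) p₀ f' ∧
      ∀ u v, area (f' u).1 (f' v).1 + area (f' u).2 (f' v).2
        = ε * (a⁻¹) ^ 2 * area u.1 v.1 + area u.2 v.2 := by
  obtain ⟨g', hg, hg'⟩ := hasFDerivAt_planeMap hK hε hKε (nsq_cell_localLift_pos ha p₀)
    (b := (localLift p₀ p₀).2) (nsq_lt_one p₀.2)
  have k₁ := (hasMFDerivAt_torusSection p₀.1.1).comp p₀
    ((hasMFDerivAt_opens_val (puncturedTorus a) p₀.1).comp p₀
      (hasMFDerivAt_fst (I := 𝓘(ℝ).prod 𝓘(ℝ)) (I' := 𝓘(ℝ, ℝ × ℝ)) p₀))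
  have k₂ := (HasFDerivAt.const_smul (hasFDerivAt_id (torusSection p₀.1.1 p₀.1.1))
    a⁻¹).hasMFDerivAt.comp p₀ k₁
  have k₃ := (hasMFDerivAt_opens_val (I := 𝓘(ℝ, ℝ × ℝ)) (disc 1) p₀.2).comp p₀
    (hasMFDerivAt_snd (I := 𝓘(ℝ).prod 𝓘(ℝ)) (I' := 𝓘(ℝ, ℝ × ℝ)) p₀)
  have k₄ := hg.hasMFDerivAt.comp p₀ (hasMFDerivAt_prodMk_space k₂ k₃)
  have k₅ := (hasFDerivAt_fst (𝕜 := ℝ) (E := ℝ × ℝ) (F := ℝ × ℝ)).hasMFDerivAt.comp p₀ k₄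
  have k₆ := (hasFDerivAt_snd (𝕜 := ℝ) (E := ℝ × ℝ) (F := ℝ × ℝ)).hasMFDerivAt.comp p₀ k₄
  have k₇ := (k₅.prodMk k₆).congr_of_eventuallyEq (f₁ := puncturedTorusMap K ε a) (by
    filter_upwards [puncturedTorusMap_eventuallyEq K ha p₀] with p hp
    exact hp ε)
  refine ⟨_, k₇, fun u v => ?_⟩
  refine (hg' (a⁻¹ • u.1, u.2) (a⁻¹ • v.1, v.2)).trans ?_
  simp [area]
  ring

end PuncturedTorusMap

/-! ### Immersion, openness and the pull-back identity -/

section SymplecticEmbedding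

variable {K ε a : ℝ}

/-- A vector in the kernel is orthogonal to everything for a nondegenerate form. -/
theorem injective_of_area {k : ℝ} (hk : k ≠ 0)
    {f' : (ℝ × ℝ) × (ℝ × ℝ) →L[ℝ] (ℝ × ℝ) × (ℝ × ℝ)}
    (h : ∀ u v, area (f' u).1 (f' v).1 + area (f' u).2 (f' v).2
      = k * area u.1 v.1 + area u.2 v.2) : Function.Injective f' := by
  refine (injective_iff_map_eq_zero f').2 fun u hu => ?_
  have h' : ∀ v : (ℝ × ℝ) × (ℝ × ℝ), k * area u.1 v.1 + area u.2 v.2 = 0 := fun v => by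
    rw [← h, hu]; simp [area]
  have h₀ : ∀ u : ℝ × ℝ, area u 0 = 0 := fun u => by simp [area]
  refine Prod.ext (area_zero_left _ fun v => ?_) (area_zero_left _ fun v => ?_)
  · have := h' (v, 0)
    rw [h₀, add_zero] at this
    exact (mul_eq_zero.1 this).resolve_left hk
  · have := h' (0, v)
    rwa [h₀, mul_zero, zero_add] at this

/-- The derivative is injective, hence surjective by equality of dimensions, and the inverse
function theorem applies. -/
theorem map_nhds_planeMap (hK : 0 < K) (hε : 0 < ε) (hKε : K * ε < 2 * Real.pi) {z b : ℝ × ℝ}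
    (hz : 0 < nsq (cell z)) (hb : nsq b < 1) :
    Filter.map (fun p : (ℝ × ℝ) × (ℝ × ℝ) => planeMap K ε p.1 p.2) (nhds (z, b))
      = nhds (planeMap K ε z b) := by
  obtain ⟨f', hf, hf'⟩ := hasFDerivAt_planeMap hK hε hKε hz hb
  have hc : ContDiffAt ℝ ∞ (fun p : (ℝ × ℝ) × (ℝ × ℝ) => planeMap K ε p.1 p.2) (z, b) :=
    ContDiffAt.comp (g := fun x : ℝ × ((ℝ × ℝ) × (ℝ × ℝ)) => planeMap K x.1 x.2.1 x.2.2)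
      (f := fun p => (ε, p)) (z, b) (contDiffAt_planeMap hK hε hKε hz hb) (by fun_prop)
  refine (hc.hasStrictFDerivAt' hf (by simp)).map_nhds_eq_of_surj ?_
  have := LinearMap.injective_iff_surjective.1
    (show Function.Injective (f' : (ℝ × ℝ) × (ℝ × ℝ) →ₗ[ℝ] (ℝ × ℝ) × (ℝ × ℝ)) from
      injective_of_area hε.ne' hf')
  exact LinearMap.range_eq_top.2 this

/-- Openness of the lifted map descends, because neighbourhoods in the quotient pull back along the
continuous map `w ↦ (torusProj a (a • w.1), w.2)`. -/
theorem isOpenMap_puncturedTorusMap (ha : a ≠ 0) (hK : 0 < K) (hε : 0 < ε)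
    (hKε : K * ε < 2 * Real.pi) : IsOpenMap (puncturedTorusMap K ε a) := by
  refine IsOpenMap.of_nhds_le fun p N hN => ?_
  rw [Filter.mem_map] at hN
  have hz := nsq_cell_pos_of_mem ha (z := torusRep p.1.1)
    (by rw [torusProj_torusRep]; exact p.1.2)
  have hm := map_nhds_planeMap hK hε hKε hz (nsq_lt_one p.2)
  have he : Topology.IsOpenEmbedding
      (Prod.map Subtype.val Subtype.val : puncturedTorus a × disc 1 → Torus a × (ℝ × ℝ)) :=
    (puncturedTorus a).isOpenEmbedding'.prodMap (disc 1).isOpenEmbedding'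
  have hW := he.isOpenMap.image_mem_nhds hN
  have hc : Continuous fun w : (ℝ × ℝ) × (ℝ × ℝ) => (torusProj a (a • w.1), w.2) :=
    ((continuous_torusProj a).comp (continuous_fst.const_smul a)).prodMk continuous_snd
  have hW' := hc.continuousAt (x := (a⁻¹ • torusRep p.1.1, p.2.1)).preimage_mem_nhds
    (t := Prod.map Subtype.val Subtype.val '' (puncturedTorusMap K ε a ⁻¹' N))
    (by rw [smul_inv_smul₀ ha, torusProj_torusRep]; exact hW)
  change N ∈ nhds (planeMap K ε (a⁻¹ • torusRep p.1.1) p.2.1)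
  rw [← hm, Filter.mem_map]
  filter_upwards [hW'] with w hw
  obtain ⟨p', hp', e⟩ := hw
  simp only [Prod.map, Prod.mk.injEq] at e
  have := puncturedTorusMap_eq (K := K) (ε := ε) ha p' e.1.symm
  rw [inv_smul_smul₀ ha, e.2] at this
  rw [Set.mem_preimage, ← this]
  exact hp'

theorem isSymplecticEmbedding_puncturedTorusMap (ha : 0 < a) (haε : a ^ 2 = ε) (hK : 0 < K)
    (hε : 0 < ε) (hKε : K * ε < 2 * Real.pi) :
    IsSymplecticEmbedding ((puncturedTorusForm a).prod (discForm 1)) (planeForm.prod planeForm)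
      (puncturedTorusMap K ε a) where
  contMDiff := contMDiff_puncturedTorusMap ha.ne' hK hε hKε
  immersion p := by
    obtain ⟨f', hf, hf'⟩ := hasMFDerivAt_puncturedTorusMap ha.ne' hK hε hKε p
    rw [hf.mfderiv]
    exact injective_of_area (mul_pos hε (by positivity)).ne' hf'
  isEmbedding := (Topology.IsOpenEmbedding.of_continuous_injective_isOpenMap
    (contMDiff_puncturedTorusMap ha.ne' hK hε hKε).continuous
    (puncturedTorusMap_injective ha.ne' hK hε hKε)
    (isOpenMap_puncturedTorusMap ha.ne' hK hε hKε)).isEmbedding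
  pullback_eq := by
    funext p u v
    obtain ⟨f', hf, hf'⟩ := hasMFDerivAt_puncturedTorusMap ha.ne' hK hε hKε p
    have h := hf' u v
    -- The area `a ^ 2` of the torus cancels the factor `ε`.
    rw [← haε, inv_pow, mul_inv_cancel₀ (by positivity), one_mul] at h
    have e₁ := (hasMFDerivAt_opens_val (I := 𝓘(ℝ).prod 𝓘(ℝ)) (puncturedTorus a) p.1).mfderiv
    have e₂ := (hasMFDerivAt_opens_val (I := 𝓘(ℝ, ℝ × ℝ)) (disc 1) p.2).mfderiv
    simp only [FormField.prod, FormField.pullback, puncturedTorusForm, discForm, mfderiv_fst,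
      mfderiv_snd, hf.mfderiv, e₁, e₂]
    exact h

end SymplecticEmbedding

/-- The side `a` enters only through the rescaled representative, independently of `ε`. This
transfers the family to the fixed torus of side 1. -/
theorem puncturedTorusMap_scale {K ε a : ℝ} (ha : 0 < a) (b : puncturedTorus 1 × disc 1) :
    puncturedTorusMap K ε 1 b
      = puncturedTorusMap K ε a (puncturedTorusScale a ha b.1, b.2) := by
  have h : torusProj a (a • torusRep b.1.1) = (puncturedTorusScale a ha b.1).1 := by
    have := torusProj_torusRep b.1.1
    rw [puncturedTorusScale]
    simp only
    conv_rhs => rw [← this]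
    simp only [torusProj, AddCircle.equivAddCircle_apply_mk]
    ext <;> simp [mul_comm]
  rw [puncturedTorusMap_eq (z := a • torusRep b.1.1) ha.ne' _ h, inv_smul_smul₀ ha.ne',
    puncturedTorusMap, inv_one, one_smul]

end

theorem mainTheorem6 :
    ∃ ε₀ : ℝ, 0 < ε₀ ∧ ∃ c : ℝ, 0 < c ∧
      ∃ I : ∀ ε : ℝ, puncturedTorus (Real.sqrt ε) × disc 1 → (ℝ × ℝ) × (ℝ × ℝ),
        (∀ ε ∈ Set.Ioc 0 ε₀,
          IsSymplecticEmbedding ((puncturedTorusForm (Real.sqrt ε)).prod (discForm 1))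
            (planeForm.prod planeForm) (I ε) ∧
          Set.range (I ε) ⊆
            (disc (Real.sqrt 2 + c * ε) : Set (ℝ × ℝ)) ×ˢ (disc (Real.sqrt 2) : Set (ℝ × ℝ))) ∧
        IsSmoothFamily ((𝓘(ℝ).prod 𝓘(ℝ)).prod 𝓘(ℝ, ℝ × ℝ)) (𝓘(ℝ, ℝ × ℝ).prod 𝓘(ℝ, ℝ × ℝ))
          (Set.Ioc 0 ε₀)
          (fun ε hε (b : puncturedTorus 1 × disc 1) =>
            (puncturedTorusScale (Real.sqrt ε) (Real.sqrt_pos.2 hε.1) b.1, b.2))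
          I := by
  obtain ⟨C, hC⟩ := exists_total_le
  set K := 1 + 2 * C
  have hKt : ∀ q, 1 + 2 * total q ≤ K := fun q => by have := hC q; simp only [K]; linarith
  have hK : 0 < K := by linarith [hKt 0, total_pos 0]
  have hpi := Real.pi_gt_three
  -- The radius estimate uses `K * ε ≤ 1`, whereas smoothness needs only `K * ε < 2π`; so `(0, 2 /
  -- K)` leaves room beyond the end point.
  refine ⟨1 / K, by positivity, K, hK, fun ε => puncturedTorusMap K ε (Real.sqrt ε),
    fun ε hε => ?_, Set.Ioo 0 (2 / K), fun x => puncturedTorusMap K x.1 1 x.2,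
    isOpen_Ioo, ?_, ?_, ?_⟩
  · have hKε : K * ε ≤ 1 := by
      have := hε.2
      rw [le_div_iff₀ hK] at this; linarith
    refine ⟨isSymplecticEmbedding_puncturedTorusMap (Real.sqrt_pos.2 hε.1)
      (Real.sq_sqrt hε.1.le) hK hε.1 (by linarith), ?_⟩
    rintro _ ⟨p, rfl⟩
    obtain ⟨h₁, h₂⟩ := planeMap_mem (z := (Real.sqrt ε)⁻¹ • torusRep p.1.1) hKt hε.1 hKε
      (nsq_lt_one p.2)
    have h₃ : 0 < Real.sqrt 2 := Real.sqrt_pos.2 two_pos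
    have h₄ := mul_pos hK hε.1
    refine ⟨(mem_disc_iff (by linarith)).2 h₁, (mem_disc_iff h₃).2 ?_⟩
    rw [Real.sq_sqrt zero_le_two]
    exact h₂
  · exact fun ε hε => ⟨hε.1, hε.2.trans_lt (div_lt_div_of_pos_right one_lt_two hK)⟩
  · rintro ⟨ε, p⟩ ⟨hε, -⟩
    have hKε : K * ε < 2 := by
      have := hε.2
      rw [lt_div_iff₀ hK] at this; linarith
    exact (contMDiffAt_puncturedTorusMap one_ne_zero hK hε.1 (by linarith) p).contMDiffWithinAt
  · exact fun ε hε b => puncturedTorusMap_scale (Real.sqrt_pos.2 hε.1) b
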